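/- **Exponential de Finetti theorem.** Write $\mathcal H=\mathbb C^d$, let $S(\mathcal H)$ be its set of unit vectors (pure states), and for $|\varphi\rangle\in\mathcal H^{\otimes n}$ and $r\in\{0,\dots,n\}$ let $$\Delta_r(|\varphi\rangle)=\mathrm{span}\{P|\varphi\rangle : P \text{ a unitary on } \mathcal H^{\otimes n} \text{ acting as the identity on at least } n-r \text{ of the } n \text{ subsystems}\}.$$ For a density matrix $\tau$ on $\mathcal H^{\otimes n}$ let the quantum Hamming distance $\Delta(\tau,|\varphi\rangle)$ be the minimum $r$ such that $\tau$ is supported on $\Delta_r(|\varphi\rangle)$. There is a universal constant $C$ such that the following holds for all integers $d\ge 1$, $n\ge 1$, $k\ge 0$ with $n+k\ge 2$. Let $\rho$ be a rank-one density matrix on $\mathcal H^{\otimes (n+k)}$ that is invariant under permutation of the $n+k$ subsystems, i.e. $W_\sigma\rho W_\sigma^\dagger=\rho$ for every permutation $\sigma$, where $W_\sigma$ permutes the tensor factors. Let $\mathrm d\psi$ be the unitarily invariant (Haar) probability measure on $S(\mathcal H)$, and let $\nu$ be the measure on $S(\mathcal H)$ proportional to $\mathrm{Tr}\big((\mathbb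 I\otimes|\psi\rangle\langle\psi|^{\otimes k})\rho\big)\,\mathrm d\psi$, normalized to total mass one (with $\nu=0$ if this weight vanishes almost everywhere). Then: 1. If $\rho$ is supported on the symmetric subspace of $\mathcal H^{\otimes(n+k)}$, then $\nu$ is a probability measure. 2. For every $r\in\{0,\dots,n\}$ there are density matrices $\tau_\psi$ on $\mathcal H^{\otimes n}$, one for each $|\psi\rangle\in S(\mathcal H)$, depending $\nu$-integrably on $\psi$, such that $\Delta(\tau_\psi,|\psi\rangle^{\otimes n})\le r$ for all $|\psi\rangle\in S(\mathcal H)$ and $$\Big\|\mathrm{Tr}_k(\rho)-\int_{S(\mathcal H)}\tau_\psi\,\mathrm d\nu(\psi)\Big\|_1\le (n+k)^{C d}\,\exp\Big(-\frac r6\min\Big\{\frac kn,1\Big\}\Big),$$ where $\mathrm{Tr}_k$ is the partial trace over the last $k$ subsystems and $\|\cdot\|_1$ is the trace norm. -/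

import Mathlib

open scoped Matrix Kronecker ENNReal ComplexOrder

noncomputable section

/-- The computational basis of `(ℂ^d)^{⊗m}`: words of length `m` over `d` letters. Vectors of
`(ℂ^d)^{⊗m}` are functions `Word d m → ℂ`, operators are square matrices indexed by `Word d m`. -/
abbrev Word (d m : ℕ) : Type := Fin m → Fin d

/-- Operators on `(ℂ^d)^{⊗m}`. -/
abbrev Op (d m : ℕ) : Type := Matrix (Word d m) (Word d m) ℂ

/-- Unit vectors `|ψ⟩` of `ℂ^d`. -/
abbrev PureState (d : ℕ) : Type := Metric.sphere (0 : EuclideanSpace ℂ (Fin d)) 1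

/-- Density matrices on `(ℂ^d)^{⊗m}`. -/
def IsDensity {d m : ℕ} (ρ : Op d m) : Prop :=
  ρ.PosSemidef ∧ ρ.trace = 1

/-- `ρ` is invariant under permutation of the `m` subsystems: `W_σ ρ W_σ† = ρ` for all `σ`. -/
def IsPermInvariant {d m : ℕ} (ρ : Op d m) : Prop :=
  ∀ (σ : Equiv.Perm (Fin m)) (x y : Word d m), ρ (x ∘ σ) (y ∘ σ) = ρ x y

/-- The symmetric subspace of `(ℂ^d)^{⊗m}`. -/
def symmetricSubspace (d m : ℕ) : Submodule ℂ (Word d m → ℂ) where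
  carrier := {v | ∀ (σ : Equiv.Perm (Fin m)) (x : Word d m), v (x ∘ σ) = v x}
  add_mem' := fun {v w} hv hw σ x => by simp only [Pi.add_apply, hv σ x, hw σ x]
  zero_mem' := fun _ _ => rfl
  smul_mem' := fun c v hv σ x => by simp only [Pi.smul_apply, hv σ x]

/-- `ρ` is supported on the subspace `V`. -/
def SupportedOn {d m : ℕ} (ρ : Op d m) (V : Submodule ℂ (Word d m → ℂ)) : Prop :=
  LinearMap.range ρ.mulVecLin ≤ V

/-- The tensor power `|ψ⟩^{⊗m}`. -/
def tensorPow {d : ℕ} (ψ : PureState d) (m : ℕ) : Word d m → ℂ :=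
  fun x => ∏ i, (ψ : EuclideanSpace ℂ (Fin d)) (x i)

/-- The projector `|ψ⟩⟨ψ|^{⊗m}`. -/
def projPow {d : ℕ} (ψ : PureState d) (m : ℕ) : Op d m :=
  Matrix.vecMulVec (tensorPow ψ m) (star (tensorPow ψ m))

/-- `P` acts as the identity on the subsystems in `T`: `P = 𝕀_T ⊗ U` with `U` acting on the other
subsystems. -/
def ActsTriviallyOn {d m : ℕ} (P : Op d m) (T : Finset (Fin m)) : Prop :=
  ∃ U : Matrix ({i // i ∉ T} → Fin d) ({i // i ∉ T} → Fin d) ℂ, ∀ x y : Word d m,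
    P x y = if ∀ i ∈ T, x i = y i then U (fun i => x i) (fun i => y i) else 0

/-- `P` is an `r`-local unitary: it acts as the identity on at least `m - r` subsystems. -/
def IsLocalUnitary {d m : ℕ} (r : ℕ) (P : Op d m) : Prop :=
  P ∈ Matrix.unitaryGroup (Word d m) ℂ ∧ ∃ T : Finset (Fin m), m - r ≤ T.card ∧ ActsTriviallyOn P T

/-- The quantum Hamming ball of radius `r` around `φ`. -/
def hammingBall {d m : ℕ} (r : ℕ) (φ : Word d m → ℂ) : Submodule ℂ (Word d m → ℂ) :=
  Submodule.span ℂ {v | ∃ P : Op d m, IsLocalUnitary r P ∧ v = P *ᵥ φ}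

/-- The quantum Hamming distance of `τ` to `φ`: the least `r ∈ {0, …, m}` such that `τ` is
supported on the quantum Hamming ball of radius `r` around `φ` (`⊤` if there is none). -/
def quantumHammingDist {d m : ℕ} (τ : Op d m) (φ : Word d m → ℂ) : ℕ∞ :=
  ⨅ (r : ℕ) (_ : r ≤ m ∧ SupportedOn τ (hammingBall r φ)), (r : ℕ∞)

/-- The partial trace over the last `k` subsystems. -/
def partialTraceLast {d : ℕ} (n k : ℕ) (ρ : Op d (n + k)) : Op d n :=
  Matrix.of fun x y => ∑ z : Word d k, ρ (Fin.append x z) (Fin.append y z)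

/-- The operator `A ⊗ B`, with `A` acting on the first `n` and `B` on the last `k` subsystems. -/
def tensorOp {d n k : ℕ} (A : Op d n) (B : Op d k) : Op d (n + k) :=
  Matrix.reindex (Fin.appendEquiv n k) (Fin.appendEquiv n k) (A ⊗ₖ B)

/-- The trace norm: the sum of the singular values. -/
def traceNorm {ι : Type*} [Fintype ι] [DecidableEq ι] (A : Matrix ι ι ℂ) : ℝ :=
  ∑ i, Real.sqrt ((Matrix.isHermitian_conjTranspose_mul_self A).eigenvalues i)

/-- The Haar measure on the pure states of `ℂ^d`: the surface measure of the unit sphere,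
normalized to a probability measure. -/
def haarPure (d : ℕ) : MeasureTheory.Measure (PureState d) :=
  ((MeasureTheory.volume : MeasureTheory.Measure (EuclideanSpace ℂ (Fin d))).toSphere Set.univ)⁻¹ •
    (MeasureTheory.volume : MeasureTheory.Measure (EuclideanSpace ℂ (Fin d))).toSphere

/-- The Haar measure on pure states weighted by `Tr((𝕀 ⊗ |ψ⟩⟨ψ|^{⊗k}) ρ)`. -/
def weightedHaar {d : ℕ} (n k : ℕ) (ρ : Op d (n + k)) : MeasureTheory.Measure (PureState d) :=
  (haarPure d).withDensity fun ψ =>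
    ENNReal.ofReal (tensorOp (1 : Op d n) (projPow ψ k) * ρ).trace.re

/-- The measure `ν`: the weighted Haar measure, normalized to total mass one (it is the zero
measure if the weight vanishes almost everywhere). -/
def deFinettiMeasure {d : ℕ} (n k : ℕ) (ρ : Op d (n + k)) : MeasureTheory.Measure (PureState d) :=
  (weightedHaar n k ρ Set.univ)⁻¹ • weightedHaar n k ρ

/-- The mixture `∫ τ_ψ dν(ψ)`, computed entrywise. -/
def mixture {d n : ℕ} (ν : MeasureTheory.Measure (PureState d)) (τ : PureState d → Op d n) :
    Op d n :=
  Matrix.of fun x y => ∫ ψ, τ ψ x y ∂ν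

end

/-!
Write `ρ = |v⟩⟨v|`. A permutation-invariant `v` is an eigenvector of all permutations, so it is either
symmetric or it changes sign under every transposition. In the second case `n + k ≤ d`, and the
claimed bound exceeds `2`, the most that the trace norm can be
(`mem_symmetricSubspace_of_isPermInvariant`, `two_le_bound`).

Let `v` be symmetric and `a_ψ = (𝕀 ⊗ ⟨ψ|^{⊗k}) v`. The average of `|ψ⟩⟨ψ|^{⊗k}` is `1 / N` times the
projector onto the symmetric subspace, where `N ≤ (k + 1) ^ d` is its dimension; this comes from the
moments of a complex Gaussian, by polar coordinates (`integral_tensorPow_mul_star`). Hence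
`Tr_k ρ = N ∫ |a_ψ⟩⟨a_ψ| dψ`, while `dν = N ‖a_ψ‖² dψ`.

For fixed `ψ`, the projectors `errorProj ψ S` onto the vectors that are orthogonal to `ψ` exactly at the
positions in `S` resolve the identity. On a symmetric vector their weights depend on the number of
errors `|S|` only, and an error pattern of `a_ψ` is a pattern of `v` without errors on the last `k`
subsystems. So more than `r` errors occur in `a_ψ` with weight at most
`(n / (n + k)) ^ r ≤ exp (-(r / 3) min (k / n) 1)` (`l2norm_sub_fewErrorsProj_contractPow_le`).
The state `τ_ψ` is the normalized component of `a_ψ` with at most `r` errors. It lies in the Hamming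
ball, because the unitaries on any `r` subsystems span all operators there (`mem_hammingBall`).

Finally the trace norm is attained by pairing with a contraction (`exists_contraction_traceNorm_eq`),
which reduces the estimate to a pointwise one in `ψ` (`norm_expectation_sub_le`), at the cost of
a factor `3 N`.
-/

open MeasureTheory

/-! ### Moments of the uniform measure on pure states -/

/-- The moments of the Gaussian on `ℂ`; those with `a ≠ b` vanish by rotation invariance. -/
lemma integral_gaussian_moment (a b : ℕ) :
    ∫ z : ℂ, z ^ a * (star z) ^ b * ((Real.exp (-‖z‖ ^ 2) : ℝ) : ℂ) =
      if a = b then (Real.pi : ℂ) * (a.factorial : ℂ) else 0 := by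
  split_ifs with h
  · subst h
    have h1 := Complex.integral_rpow_mul_exp_neg_rpow (p := 2) (q := (2 * a : ℕ)) (by norm_num)
      (by have : (0 : ℝ) ≤ ((2 * a : ℕ) : ℝ) := Nat.cast_nonneg _
          linarith)
    have h2 : ((((2 * a : ℕ) : ℝ) + 2) / 2) = (a : ℝ) + 1 := by push_cast; ring
    rw [h2, Real.Gamma_nat_eq_factorial] at h1
    have h3 : ∀ z : ℂ, z ^ a * (star z) ^ a * ((Real.exp (-‖z‖ ^ 2) : ℝ) : ℂ) =
        ((‖z‖ ^ (((2 * a : ℕ) : ℝ)) * Real.exp (-‖z‖ ^ (2 : ℝ)) : ℝ) : ℂ) := by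
      intro z
      rw [← mul_pow, Real.rpow_natCast, pow_mul, ← Real.rpow_natCast ‖z‖ 2]
      have : z * star z = ((‖z‖ ^ 2 : ℝ) : ℂ) := by
        rw [Complex.star_def, Complex.mul_conj, Complex.normSq_eq_norm_sq]
      rw [this]; push_cast; simp
    simp_rw [h3]
    rw [integral_complex_ofReal, h1]
    push_cast; ring
  · obtain ⟨u, hne⟩ : ∃ u : Circle, (u : ℂ) ^ a * (star (u : ℂ)) ^ b ≠ 1 := by
      have hab : ((a : ℝ) - b) ≠ 0 := sub_ne_zero.mpr (by exact_mod_cast h)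
      refine ⟨Circle.exp (Real.pi / (a - b)), ?_⟩
      rw [Circle.coe_exp, Complex.star_def, ← Complex.exp_conj, ← Complex.exp_nat_mul,
        ← Complex.exp_nat_mul, ← Complex.exp_add]
      have hab' : ((a : ℂ) - b) ≠ 0 := by exact_mod_cast hab
      have : (a : ℂ) * (((Real.pi / (a - b) : ℝ) : ℂ) * Complex.I) +
          b * (starRingEnd ℂ) (((Real.pi / (a - b) : ℝ) : ℂ) * Complex.I) = Real.pi * Complex.I := by
        simp only [map_mul, Complex.conj_ofReal, Complex.conj_I]
        push_cast
        field_simp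
        ring
      rw [this, Complex.exp_pi_mul_I]
      norm_num
    have hm := (LinearIsometryEquiv.measurePreserving (rotation u)).integral_comp
      (rotation u).toHomeomorph.measurableEmbedding
      (fun z : ℂ => z ^ a * (star z) ^ b * ((Real.exp (-‖z‖ ^ 2) : ℝ) : ℂ))
    have h4 : ∀ z : ℂ, (rotation u z) ^ a * (star (rotation u z)) ^ b *
        ((Real.exp (-‖rotation u z‖ ^ 2) : ℝ) : ℂ) =
        ((u : ℂ) ^ a * (star (u : ℂ)) ^ b) *
          (z ^ a * (star z) ^ b * ((Real.exp (-‖z‖ ^ 2) : ℝ) : ℂ)) := by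
      intro z
      rw [LinearIsometryEquiv.norm_map, rotation_apply, star_mul', mul_pow, mul_pow]
      ring
    simp only [h4] at hm
    rw [integral_const_mul] at hm
    have := sub_eq_zero.mpr hm
    rw [← sub_one_mul] at this
    exact (mul_eq_zero.mp this).resolve_left (sub_ne_zero.mpr hne)

/-- Integration in polar coordinates of a homogeneous function against the Gaussian. -/
lemma integral_homogeneous_gaussian {E : Type*} [NormedAddCommGroup E] [NormedSpace ℝ E]
    [Nontrivial E] [FiniteDimensional ℝ E] [MeasurableSpace E] [BorelSpace E]
    (μ : Measure E) [μ.IsAddHaarMeasure] (m : ℕ) :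
    ∃ R : ℂ, ∀ f : E → ℂ, (∀ (r : ℝ) (x : E), f (r • x) = (r : ℂ) ^ m * f x) →
      ∫ x, f x * ((Real.exp (-‖x‖ ^ 2) : ℝ) : ℂ) ∂μ = (∫ ψ, f ψ ∂μ.toSphere) * R := by
  refine ⟨∫ r : Set.Ioi (0 : ℝ), ((r : ℝ) : ℂ) ^ m * ((Real.exp (-(r : ℝ) ^ 2) : ℝ) : ℂ)
    ∂(Measure.volumeIoiPow (Module.finrank ℝ E - 1)), fun f hf => ?_⟩
  rw [← integral_prod_mul, ← μ.measurePreserving_homeomorphUnitSphereProd.integral_comp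
    (Homeomorph.measurableEmbedding _)]
  have key : ∀ x : ({0}ᶜ : Set E), f (homeomorphUnitSphereProd E x).1 *
      ((((homeomorphUnitSphereProd E x).2 : ℝ) : ℂ) ^ m *
        ((Real.exp (-((homeomorphUnitSphereProd E x).2 : ℝ) ^ 2) : ℝ) : ℂ)) =
      (fun y : E => f y * ((Real.exp (-‖y‖ ^ 2) : ℝ) : ℂ)) x := by
    intro x
    have hx : ‖(x : E)‖ ≠ 0 := norm_ne_zero_iff.mpr x.2
    have h1 : (x : E) = ‖(x : E)‖ • ((homeomorphUnitSphereProd E x).1 : E) := by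
      rw [homeomorphUnitSphereProd_apply_fst_coe, smul_smul, mul_inv_cancel₀ hx, one_smul]
    have h2 : f x = (‖(x : E)‖ : ℂ) ^ m * f (homeomorphUnitSphereProd E x).1 := by
      rw [← hf, ← h1]
    simp only [homeomorphUnitSphereProd_apply_snd_coe]
    rw [h2]; ring
  rw [integral_congr_ae (Filter.Eventually.of_forall key)]
  rw [integral_subtype_comap (measurableSet_singleton _).compl
      fun y : E => f y * ((Real.exp (-‖y‖ ^ 2) : ℝ) : ℂ), restrict_compl_singleton]

/-- Gaussian moments on `ℂ^d`: the monomials are orthogonal. -/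
lemma integral_gaussian_moment_euclidean (d : ℕ) :
    ∃ κ : ℂ, κ ≠ 0 ∧ ∀ a b : Fin d → ℕ,
      ∫ x : EuclideanSpace ℂ (Fin d), (∏ i, (x i) ^ a i * (star (x i)) ^ b i) *
        ((Real.exp (-‖x‖ ^ 2) : ℝ) : ℂ) = if a = b then κ * ∏ i, ((a i).factorial : ℂ) else 0 := by
  -- The volume of `EuclideanSpace ℂ (Fin d)` is compared with the product measure up to a scalar only.
  let L : (Fin d → ℂ) ≃L[ℝ] EuclideanSpace ℂ (Fin d) :=
    (PiLp.continuousLinearEquiv 2 ℝ (fun _ : Fin d => ℂ)).symm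
  let μ : Measure (EuclideanSpace ℂ (Fin d)) := Measure.map L volume
  have : μ.IsAddHaarMeasure := L.isAddHaarMeasure_map volume
  have hv : (volume : Measure (EuclideanSpace ℂ (Fin d))) =
      Measure.addHaarScalarFactor volume μ • μ := Measure.isAddLeftInvariant_eq_smul _ _
  have hpos := Measure.addHaarScalarFactor_pos_of_isAddHaarMeasure
    (volume : Measure (EuclideanSpace ℂ (Fin d))) μ
  set s := Measure.addHaarScalarFactor (volume : Measure (EuclideanSpace ℂ (Fin d))) μ
  refine ⟨(s : ℝ) * (Real.pi : ℂ) ^ d, ?_, fun a b => ?_⟩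
  · refine mul_ne_zero ?_ (pow_ne_zero _ (by exact_mod_cast Real.pi_ne_zero))
    exact_mod_cast hpos.ne'
  have hL : MeasurableEmbedding L := L.toHomeomorph.measurableEmbedding
  rw [hv, integral_smul_nnreal_measure, hL.integral_map]
  have h1 : ∀ x : Fin d → ℂ, (∏ i, ((L x) i) ^ a i * (star ((L x) i)) ^ b i) *
        ((Real.exp (-‖L x‖ ^ 2) : ℝ) : ℂ) =
        ∏ i, ((x i) ^ a i * (star (x i)) ^ b i * ((Real.exp (-‖x i‖ ^ 2) : ℝ) : ℂ)) := by
    intro x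
    have hL : ∀ i, (L x) i = x i := fun i => rfl
    rw [EuclideanSpace.norm_sq_eq, ← Finset.sum_neg_distrib, Real.exp_sum]
    simp only [hL, Finset.prod_mul_distrib]
    push_cast
    rfl
  have h2 : ∫ x : Fin d → ℂ, (∏ i, ((L x) i) ^ a i * (star ((L x) i)) ^ b i) *
        ((Real.exp (-‖L x‖ ^ 2) : ℝ) : ℂ) =
      ∏ i, if a i = b i then (Real.pi : ℂ) * ((a i).factorial : ℂ) else 0 := by
    simp only [h1]
    rw [integral_fintype_prod_volume_eq_prod
      (fun i (z : ℂ) => z ^ a i * (star z) ^ b i * ((Real.exp (-‖z‖ ^ 2) : ℝ) : ℂ))]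
    simp only [integral_gaussian_moment]
  rw [h2]
  split_ifs with h
  · subst h
    simp only [if_true, Finset.prod_mul_distrib, Finset.prod_const, Finset.card_univ, Fintype.card_fin]
    rw [NNReal.smul_def, Complex.real_smul, mul_assoc]
  · obtain ⟨i, hi⟩ := Function.ne_iff.mp h
    rw [Finset.prod_eq_zero (Finset.mem_univ i) (if_neg hi), smul_zero]

/-- The type of a word: how often each letter occurs. -/
def letterCount {d k : ℕ} (w : Word d k) (i : Fin d) : ℕ := Fintype.card {j // w j = i}

/-- The number of rearrangements of positions that turn the word `w` into the word `z`. -/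
def permCount {d k : ℕ} (w z : Word d k) : ℕ := ∑ σ : Equiv.Perm (Fin k), if w ∘ σ = z then 1 else 0

lemma prod_comp_eq_prod_pow_letterCount {d k : ℕ} (w : Word d k) (f : Fin d → ℂ) :
    ∏ j, f (w j) = ∏ i, f i ^ letterCount w i := by
  rw [← Fintype.prod_fiberwise' w f]
  simp [letterCount]

lemma letterCount_comp {d k : ℕ} (w : Word d k) (σ : Equiv.Perm (Fin k)) :
    letterCount (w ∘ σ) = letterCount w := by
  funext i
  exact Fintype.card_congr (σ.subtypeEquiv fun _ => Iff.rfl)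

lemma exists_perm_of_letterCount_eq {d k : ℕ} {w z : Word d k}
    (h : letterCount w = letterCount z) : ∃ σ : Equiv.Perm (Fin k), w ∘ σ = z := by
  have e : ∀ i, {j // z j = i} ≃ {j // w j = i} := fun i =>
    Fintype.equivOfCardEq (congrFun h i).symm
  refine ⟨(Equiv.sigmaFiberEquiv z).symm.trans ((Equiv.sigmaCongrRight e).trans
    (Equiv.sigmaFiberEquiv w)), ?_⟩
  funext j
  exact (e (z j) ⟨j, rfl⟩).2

lemma permCount_self {d k : ℕ} (w : Word d k) :
    permCount w w = ∏ i, (letterCount w i).factorial := by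
  have := DomMulAct.stabilizer_card w
  simp only [letterCount, permCount]
  rw [← this, Fintype.card_subtype, Finset.card_filter]

lemma permCount_comp {d k : ℕ} (w z : Word d k) (τ : Equiv.Perm (Fin k)) :
    permCount (w ∘ τ) z = permCount w z := by
  unfold permCount
  exact Fintype.sum_equiv (Equiv.mulLeft τ) _ _ fun σ => rfl

lemma permCount_eq {d k : ℕ} (w z : Word d k) :
    permCount w z = if letterCount w = letterCount z then
      ∏ i, (letterCount w i).factorial else 0 := by
  split_ifs with h
  · obtain ⟨τ, hτ⟩ := exists_perm_of_letterCount_eq h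
    rw [← permCount_comp w z τ, hτ, permCount_self, h]
  · refine Finset.sum_eq_zero fun σ _ => if_neg fun hσ => h ?_
    rw [← hσ, letterCount_comp]

/-- Each type of words contributes `k!` to the sum of the stabilizer orders, and there are at most
`(k + 1) ^ d` types. -/
lemma sum_permCount_self (d k : ℕ) :
    ∃ N : ℕ, N ≤ (k + 1) ^ d ∧ ∑ w : Word d k, permCount w w = N * k.factorial := by
  classical
  refine ⟨(Finset.univ.image (letterCount (d := d) (k := k))).card, ?_, ?_⟩
  · calc _ ≤ (Fintype.piFinset fun _ : Fin d => Finset.range (k + 1)).card := by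
          refine Finset.card_le_card fun a ha => ?_
          obtain ⟨w, -, rfl⟩ := Finset.mem_image.mp ha
          refine Fintype.mem_piFinset.mpr fun i => Finset.mem_range.mpr (Nat.lt_succ_of_le ?_)
          exact (Fintype.card_subtype_le _).trans_eq (Fintype.card_fin k)
      _ = _ := by simp
  · rw [← Finset.sum_fiberwise_of_maps_to (s := Finset.univ)
      (t := Finset.univ.image (letterCount (d := d) (k := k))) (g := letterCount)
      (fun w _ => Finset.mem_image_of_mem _ (Finset.mem_univ w))]
    rw [Finset.card_eq_sum_ones, Finset.sum_mul]
    refine Finset.sum_congr rfl fun a ha => ?_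
    obtain ⟨w₀, -, rfl⟩ := Finset.mem_image.mp ha
    calc _ = ∑ w with letterCount w = letterCount w₀, permCount w₀ w := by
          refine Finset.sum_congr rfl fun w hw => ?_
          rw [permCount_self, permCount_eq, if_pos (Finset.mem_filter.mp hw).2.symm,
            (Finset.mem_filter.mp hw).2]
      _ = ∑ w : Word d k, permCount w₀ w := by
          refine Finset.sum_filter_of_ne fun w _ hw => ?_
          by_contra h
          exact hw (by rw [permCount_eq, if_neg (Ne.symm h)])
      _ = 1 * k.factorial := by
          unfold permCount
          rw [Finset.sum_comm]
          simp [Fintype.card_perm]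

lemma sum_prod_mul_star {d : ℕ} (ι : Type*) [Fintype ι] [DecidableEq ι] (ψ : PureState d) :
    ∑ u : ι → Fin d, (∏ i, (ψ : EuclideanSpace ℂ (Fin d)) (u i)) *
      star (∏ i, (ψ : EuclideanSpace ℂ (Fin d)) (u i)) = 1 := by
  have h1 : ∑ i, (ψ : EuclideanSpace ℂ (Fin d)) i * star ((ψ : EuclideanSpace ℂ (Fin d)) i) = 1 := by
    have h2 : ‖(ψ : EuclideanSpace ℂ (Fin d))‖ = 1 := by simp
    have h3 := EuclideanSpace.norm_sq_eq (ψ : EuclideanSpace ℂ (Fin d))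
    rw [h2] at h3
    have h4 : ∀ z : ℂ, z * star z = ((‖z‖ ^ 2 : ℝ) : ℂ) := fun z => by
      rw [Complex.star_def, Complex.mul_conj, Complex.normSq_eq_norm_sq]
    simp only [h4]
    rw [← Complex.ofReal_sum, ← h3]; simp
  simp only [star_prod, ← Finset.prod_mul_distrib]
  have := Finset.prod_univ_sum (fun _ : ι => (Finset.univ : Finset (Fin d)))
    (fun _ i => (ψ : EuclideanSpace ℂ (Fin d)) i * star ((ψ : EuclideanSpace ℂ (Fin d)) i))
  simp only [h1, Fintype.piFinset_univ] at this
  rw [← this]; simp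

lemma sum_tensorPow_mul_star {d k : ℕ} (ψ : PureState d) :
    ∑ w, tensorPow ψ k w * star (tensorPow ψ k w) = 1 :=
  sum_prod_mul_star (Fin k) ψ

lemma continuous_tensorPow {d k : ℕ} (w : Word d k) :
    Continuous fun ψ : PureState d => tensorPow ψ k w := by
  unfold tensorPow
  fun_prop

lemma toSphere_univ_ne_zero {d : ℕ} (hd : 0 < d) :
    (volume : Measure (EuclideanSpace ℂ (Fin d))).toSphere Set.univ ≠ 0 := by
  have : NeZero d := ⟨hd.ne'⟩
  have := Measure.toSphere_ne_zero (volume : Measure (EuclideanSpace ℂ (Fin d)))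
  exact fun h => this (Measure.measure_univ_eq_zero.mp h)

lemma isProbabilityMeasure_haarPure {d : ℕ} (hd : 0 < d) : IsProbabilityMeasure (haarPure d) :=
  ⟨ENNReal.inv_mul_cancel (toSphere_univ_ne_zero hd) (measure_ne_top _ _)⟩

/-- The average of `|ψ⟩⟨ψ|^{⊗k}` over the pure states is the projector onto the symmetric subspace,
divided by the dimension `N` of that subspace. -/
lemma integral_tensorPow_mul_star {d : ℕ} (hd : 0 < d) (k : ℕ) :
    ∃ N : ℕ, 0 < N ∧ N ≤ (k + 1) ^ d ∧ ∀ w z : Word d k,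
      ∫ ψ, tensorPow ψ k w * star (tensorPow ψ k z) ∂haarPure d =
        (permCount w z : ℂ) / (N * k.factorial) := by
  have : NeZero d := ⟨hd.ne'⟩
  have := isProbabilityMeasure_haarPure hd
  obtain ⟨R, hR⟩ := integral_homogeneous_gaussian
    (volume : Measure (EuclideanSpace ℂ (Fin d))) (2 * k)
  obtain ⟨κ, hκ, hG⟩ := integral_gaussian_moment_euclidean d
  obtain ⟨N, hN, hsum⟩ := sum_permCount_self d k
  set μ := (volume : Measure (EuclideanSpace ℂ (Fin d))).toSphere with hμ
  -- The sphere moments are proportional to the Gaussian moments, with an unspecified constant.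
  have h1 : ∀ w z : Word d k, (∫ ψ, tensorPow ψ k w * star (tensorPow ψ k z) ∂μ) * R =
      κ * permCount w z := by
    intro w z
    have h2 := hR (fun x => (∏ j, x (w j)) * star (∏ j, x (z j))) (by
      intro r x
      simp only [PiLp.smul_apply, Complex.real_smul, Finset.prod_mul_distrib, Finset.prod_const,
        Finset.card_univ, Fintype.card_fin, star_mul', star_pow, Complex.star_def,
        Complex.conj_ofReal, star_prod]
      ring)
    have h3 := hG (letterCount w) (letterCount z)
    simp only [star_prod] at h2
    simp only [prod_comp_eq_prod_pow_letterCount w,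
      fun x : EuclideanSpace ℂ (Fin d) =>
        prod_comp_eq_prod_pow_letterCount z (fun i => star (x i))] at h2
    simp only [← Finset.prod_mul_distrib] at h2
    rw [h3] at h2
    have h4 : κ * (permCount w z : ℂ) =
        if letterCount w = letterCount z then κ * ∏ i, ((letterCount w i).factorial : ℂ) else 0 := by
      rw [permCount_eq]; split_ifs <;> push_cast <;> simp
    rw [h4, h2, hμ]
    congr 2
    funext ψ
    simp only [tensorPow, star_prod]
    rw [prod_comp_eq_prod_pow_letterCount w,
      prod_comp_eq_prod_pow_letterCount z
        (fun i => star ((ψ : EuclideanSpace ℂ (Fin d)) i)), ← Finset.prod_mul_distrib]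
  -- The radial integral `R` is nonzero, as the Gaussian moments on the diagonal are.
  have hR0 : R ≠ 0 := by
    rintro rfl
    have := h1 (fun _ => ⟨0, hd⟩) (fun _ => ⟨0, hd⟩)
    rw [mul_zero, permCount_self] at this
    have h5 : ((∏ i, (letterCount (fun _ : Fin k => (⟨0, hd⟩ : Fin d)) i).factorial : ℕ) : ℂ) ≠ 0 :=
      Nat.cast_ne_zero.mpr (Finset.prod_ne_zero_iff.mpr fun i _ => Nat.factorial_ne_zero _)
    exact mul_ne_zero hκ h5 this.symm
  obtain ⟨c, hc⟩ : ∃ c : ℂ, ∀ w z : Word d k,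
      ∫ ψ, tensorPow ψ k w * star (tensorPow ψ k z) ∂haarPure d = c * permCount w z := by
    refine ⟨((μ Set.univ)⁻¹.toReal : ℂ) * κ / R, fun w z => ?_⟩
    rw [haarPure, integral_smul_measure, Complex.real_smul, ← hμ, eq_div_of_mul_eq hR0 (h1 w z)]
    ring
  have htr : c * (N * k.factorial) = 1 := by
    have h6 : ∑ w : Word d k, ∫ ψ, tensorPow ψ k w * star (tensorPow ψ k w) ∂haarPure d = 1 := by
      rw [← integral_finsetSum]
      · simp only [sum_tensorPow_mul_star]
        simp
      · intro w _
        refine Continuous.integrable_of_hasCompactSupport ?_ (HasCompactSupport.of_compactSpace _)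
        exact (continuous_tensorPow w).mul (continuous_tensorPow w).star
    simp only [hc, ← Finset.mul_sum] at h6
    rw [← h6]
    congr 1
    exact_mod_cast hsum.symm
  have hNk : (N * k.factorial : ℂ) ≠ 0 := right_ne_zero_of_mul_eq_one htr
  refine ⟨N, Nat.pos_of_ne_zero ?_, hN, fun w z => ?_⟩
  · rintro rfl
    simp at hNk
  · rw [hc, eq_div_of_mul_eq hNk htr]; ring

/-! ### Euclidean norm and duality for the trace norm -/

/-- The Euclidean norm of a vector indexed by `ι`; the norm of `ι → ℂ` itself is the sup norm. -/
noncomputable def l2norm {ι : Type*} [Fintype ι] (x : ι → ℂ) : ℝ :=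
  ‖(WithLp.toLp 2 x : EuclideanSpace ℂ ι)‖

section l2norm
variable {ι : Type*} [Fintype ι]

lemma l2norm_nonneg (x : ι → ℂ) : 0 ≤ l2norm x := norm_nonneg _

lemma l2norm_sq (x : ι → ℂ) : l2norm x ^ 2 = ∑ i, ‖x i‖ ^ 2 := EuclideanSpace.norm_sq_eq _

lemma star_dotProduct_self (x : ι → ℂ) : star x ⬝ᵥ x = ((l2norm x ^ 2 : ℝ) : ℂ) := by
  rw [l2norm_sq, dotProduct]
  push_cast
  refine Finset.sum_congr rfl fun i _ => ?_
  rw [Pi.star_apply, Complex.star_def, mul_comm, Complex.mul_conj, Complex.normSq_eq_norm_sq]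
  push_cast; rfl

lemma norm_star_dotProduct_le (x y : ι → ℂ) : ‖star x ⬝ᵥ y‖ ≤ l2norm x * l2norm y := by
  have := norm_inner_le_norm (𝕜 := ℂ) (WithLp.toLp 2 x : EuclideanSpace ℂ ι) (WithLp.toLp 2 y)
  rwa [EuclideanSpace.inner_toLp_toLp, dotProduct_comm] at this

lemma l2norm_eq_zero {x : ι → ℂ} : l2norm x = 0 ↔ x = 0 := by
  rw [l2norm, norm_eq_zero, WithLp.toLp_eq_zero]

lemma l2norm_smul (c : ℂ) (x : ι → ℂ) : l2norm (c • x) = ‖c‖ * l2norm x := by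
  rw [l2norm, WithLp.toLp_smul, norm_smul]; rfl

end l2norm

lemma Matrix.trace_mul_vecMulVec_star {ι : Type*} [Fintype ι] (W : Matrix ι ι ℂ) (x y : ι → ℂ) :
    (W * Matrix.vecMulVec x (star y)).trace = star y ⬝ᵥ (W *ᵥ x) := by
  rw [Matrix.mul_vecMulVec, Matrix.trace_vecMulVec, dotProduct_comm]

/-- Duality for the trace norm: it is attained by pairing with a contraction `W`, namely the adjoint
of the partial isometry in the polar decomposition. -/
lemma exists_contraction_traceNorm_eq {ι : Type*} [Fintype ι] [DecidableEq ι] (A : Matrix ι ι ℂ) :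
    ∃ W : Matrix ι ι ℂ, (traceNorm A : ℂ) = (W * A).trace ∧
      ∀ x y : ι → ℂ, ‖star x ⬝ᵥ (W *ᵥ y)‖ ≤ l2norm x * l2norm y := by
  set H := Matrix.isHermitian_conjTranspose_mul_self A
  set ev := H.eigenvalues with hev
  have hpos : ∀ i, 0 ≤ ev i := (Matrix.posSemidef_conjTranspose_mul_self A).eigenvalues_nonneg
  set V : Matrix ι ι ℂ := (H.eigenvectorUnitary : Matrix ι ι ℂ) with hV
  have hVV : Vᴴ * V = 1 := Unitary.coe_star_mul_self H.eigenvectorUnitary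
  have hVV' : V * Vᴴ = 1 := Unitary.coe_mul_star_self H.eigenvectorUnitary
  have hA : Aᴴ * A = V * Matrix.diagonal (fun i => (ev i : ℂ)) * Vᴴ := by
    conv_lhs => rw [H.spectral_theorem]
    rfl
  set D : Matrix ι ι ℂ := Matrix.diagonal (fun i => ((Real.sqrt (ev i))⁻¹ : ℂ)) with hD
  have hDH : Dᴴ = D := by
    rw [hD, Matrix.diagonal_conjTranspose]
    congr 1
    funext i
    simp
  have hsplit : ∀ i, (ev i : ℂ) = (Real.sqrt (ev i) : ℂ) * (Real.sqrt (ev i) : ℂ) := fun i => by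
    rw [← Complex.ofReal_mul, Real.mul_self_sqrt (hpos i)]
  refine ⟨V * D * Vᴴ * Aᴴ, ?_, fun x y => ?_⟩
  · have h1 : V * D * Vᴴ * Aᴴ * A = V * (D * Matrix.diagonal (fun i => (ev i : ℂ))) * Vᴴ := by
      rw [Matrix.mul_assoc (V * D * Vᴴ), hA]
      simp only [Matrix.mul_assoc]
      rw [← Matrix.mul_assoc Vᴴ V, hVV, Matrix.one_mul]
    rw [h1, Matrix.trace_mul_cycle, hVV, Matrix.one_mul, hD, Matrix.diagonal_mul_diagonal,
      Matrix.trace_diagonal, traceNorm]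
    push_cast
    refine Finset.sum_congr rfl fun i _ => ?_
    rw [← hev, hsplit i]
    by_cases h0 : (Real.sqrt (ev i) : ℂ) = 0
    · simp [h0]
    · field_simp
  · set W := V * D * Vᴴ * Aᴴ with hW
    set E : Matrix ι ι ℂ := D * Matrix.diagonal (fun i => (ev i : ℂ)) * D with hE
    have hWW : W * Wᴴ = V * E * Vᴴ := by
      rw [hW]
      simp only [Matrix.conjTranspose_mul, Matrix.conjTranspose_conjTranspose, hDH]
      rw [Matrix.mul_assoc (V * D * Vᴴ) Aᴴ, ← Matrix.mul_assoc Aᴴ A, hA, hE]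
      simp only [Matrix.mul_assoc]
      rw [← Matrix.mul_assoc Vᴴ V, hVV, Matrix.one_mul, ← Matrix.mul_assoc Vᴴ V (D * Vᴴ), hVV,
        Matrix.one_mul]
    have hEd : ∃ χ : ι → ℝ, (∀ i, 0 ≤ χ i ∧ χ i ≤ 1) ∧ E = Matrix.diagonal (fun i => (χ i : ℂ)) := by
      refine ⟨fun i => if Real.sqrt (ev i) = 0 then 0 else 1, fun i => ?_, ?_⟩
      · beta_reduce
        split_ifs <;> norm_num
      · rw [hE, hD, Matrix.diagonal_mul_diagonal, Matrix.diagonal_mul_diagonal]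
        congr 1
        funext i
        rw [hsplit i]
        beta_reduce
        split_ifs with h0
        · simp [h0]
        · have : (Real.sqrt (ev i) : ℂ) ≠ 0 := by exact_mod_cast h0
          field_simp
          simp
    obtain ⟨χ, hχ, hEχ⟩ := hEd
    have hVx : l2norm (Vᴴ *ᵥ x) ^ 2 = l2norm x ^ 2 := by
      have : star (Vᴴ *ᵥ x) ⬝ᵥ (Vᴴ *ᵥ x) = star x ⬝ᵥ x := by
        rw [Matrix.star_mulVec, Matrix.conjTranspose_conjTranspose, ← Matrix.dotProduct_mulVec,
          Matrix.mulVec_mulVec, hVV', Matrix.one_mulVec]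
      rw [star_dotProduct_self, star_dotProduct_self] at this
      exact_mod_cast this
    have hWx : l2norm (Wᴴ *ᵥ x) ^ 2 ≤ l2norm x ^ 2 := by
      have h2 : star (Wᴴ *ᵥ x) ⬝ᵥ (Wᴴ *ᵥ x) = star (Vᴴ *ᵥ x) ⬝ᵥ (E *ᵥ (Vᴴ *ᵥ x)) := by
        rw [Matrix.star_mulVec, Matrix.conjTranspose_conjTranspose, ← Matrix.dotProduct_mulVec,
          Matrix.mulVec_mulVec, hWW, Matrix.star_mulVec, Matrix.conjTranspose_conjTranspose,
          ← Matrix.dotProduct_mulVec, Matrix.mulVec_mulVec, Matrix.mulVec_mulVec,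
          ← Matrix.mul_assoc]
      have h3 : star (Vᴴ *ᵥ x) ⬝ᵥ (E *ᵥ (Vᴴ *ᵥ x)) =
          ((∑ i, χ i * ‖(Vᴴ *ᵥ x) i‖ ^ 2 : ℝ) : ℂ) := by
        rw [hEχ, dotProduct]
        push_cast
        refine Finset.sum_congr rfl fun i _ => ?_
        rw [Matrix.mulVec_diagonal, Pi.star_apply, mul_left_comm, Complex.star_def,
          ← Complex.normSq_eq_conj_mul_self, Complex.normSq_eq_norm_sq]
        push_cast; rfl
      rw [h3, star_dotProduct_self] at h2
      have h4 : l2norm (Wᴴ *ᵥ x) ^ 2 = ∑ i, χ i * ‖(Vᴴ *ᵥ x) i‖ ^ 2 := by exact_mod_cast h2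
      rw [h4, ← hVx, l2norm_sq]
      exact Finset.sum_le_sum fun i _ => mul_le_of_le_one_left (sq_nonneg _) (hχ i).2
    have h5 : star x ⬝ᵥ (W *ᵥ y) = star (Wᴴ *ᵥ x) ⬝ᵥ y := by
      rw [Matrix.star_mulVec, Matrix.conjTranspose_conjTranspose, Matrix.dotProduct_mulVec]
    rw [h5]
    refine (norm_star_dotProduct_le _ _).trans ?_
    exact mul_le_mul_of_nonneg_right (abs_le_of_sq_le_sq' hWx (l2norm_nonneg x)).2 (l2norm_nonneg y)

/-! ### Vectors in the quantum Hamming ball -/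

/-- The operator `𝕀_T ⊗ U` on `(ℂ^d)^{⊗m}`. -/
noncomputable def extendOp {d m : ℕ} (T : Finset (Fin m))
    (U : Matrix ({i // i ∉ T} → Fin d) ({i // i ∉ T} → Fin d) ℂ) : Op d m :=
  Matrix.reindex (Equiv.piEquivPiSubtypeProd (· ∈ T) fun _ => Fin d).symm
    (Equiv.piEquivPiSubtypeProd (· ∈ T) fun _ => Fin d).symm
    ((1 : Matrix ({i // i ∈ T} → Fin d) ({i // i ∈ T} → Fin d) ℂ) ⊗ₖ U)

section extendOp
variable {d m : ℕ} (T : Finset (Fin m))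
  (U : Matrix ({i // i ∉ T} → Fin d) ({i // i ∉ T} → Fin d) ℂ)

lemma extendOp_apply (x y : Word d m) : extendOp T U x y =
    (1 : Matrix ({i // i ∈ T} → Fin d) ({i // i ∈ T} → Fin d) ℂ) (fun i => x i) (fun i => y i) *
      U (fun i => x i) (fun i => y i) := rfl

lemma actsTriviallyOn_extendOp : ActsTriviallyOn (extendOp T U) T := by
  refine ⟨U, fun x y => ?_⟩
  rw [extendOp_apply, Matrix.one_apply]
  simp [funext_iff]

lemma extendOp_mem_unitaryGroup (hU : U ∈ unitary (Matrix ({i // i ∉ T} → Fin d) ({i // i ∉ T} → Fin d) ℂ)) :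
    extendOp T U ∈ Matrix.unitaryGroup (Word d m) ℂ := by
  have h := Matrix.kronecker_mem_unitary
    (one_mem (unitary (Matrix ({i // i ∈ T} → Fin d) ({i // i ∈ T} → Fin d) ℂ))) hU
  rw [Matrix.mem_unitaryGroup_iff]
  have h2 := Unitary.mul_star_self_of_mem h
  rw [Matrix.star_eq_conjTranspose] at h2 ⊢
  rw [extendOp, Matrix.conjTranspose_reindex, Matrix.reindex_apply, Matrix.reindex_apply,
    Matrix.submatrix_mul_equiv, h2, Matrix.submatrix_one_equiv]

lemma extendOp_mulVec_tensorPow (ψ : PureState d) :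
    extendOp T U *ᵥ tensorPow ψ m = fun x =>
      (∏ i : {i // i ∈ T}, (ψ : EuclideanSpace ℂ (Fin d)) (x i)) *
        (U *ᵥ fun u => ∏ i, (ψ : EuclideanSpace ℂ (Fin d)) (u i)) (fun i => x i) := by
  funext x
  rw [Matrix.mulVec, dotProduct,
    ← (Equiv.piEquivPiSubtypeProd (· ∈ T) fun _ => Fin d).symm.sum_comp, Fintype.sum_prod_type]
  have h : ∀ (s : {i // i ∈ T} → Fin d) (t : {i // i ∉ T} → Fin d),
      extendOp T U x ((Equiv.piEquivPiSubtypeProd (· ∈ T) fun _ => Fin d).symm (s, t)) *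
        tensorPow ψ m ((Equiv.piEquivPiSubtypeProd (· ∈ T) fun _ => Fin d).symm (s, t)) =
      (1 : Matrix ({i // i ∈ T} → Fin d) ({i // i ∈ T} → Fin d) ℂ) (fun i => x i) s *
        (∏ i, (ψ : EuclideanSpace ℂ (Fin d)) (s i)) *
          (U (fun i => x i) t * ∏ i, (ψ : EuclideanSpace ℂ (Fin d)) (t i)) := by
    intro s t
    have h1 : (fun i : {i // i ∈ T} =>
        (Equiv.piEquivPiSubtypeProd (· ∈ T) fun _ => Fin d).symm (s, t) i) = s := by
      funext i; simp [Equiv.piEquivPiSubtypeProd]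
    have h2 : (fun i : {i // i ∉ T} =>
        (Equiv.piEquivPiSubtypeProd (· ∈ T) fun _ => Fin d).symm (s, t) i) = t := by
      funext i; simp [Equiv.piEquivPiSubtypeProd, i.2]
    rw [extendOp_apply, h1, h2, tensorPow, ← Fintype.prod_subtype_mul_prod_subtype (· ∈ T)]
    have h1' := fun i => congrFun h1 i
    have h2' := fun i => congrFun h2 i
    simp only [h1', h2']
    rw [mul_mul_mul_comm]
    congr!
  simp only [h, ← Finset.mul_sum, ← Finset.sum_mul]
  congr 1
  simp [Matrix.one_apply]

end extendOp

/-- Vectors that agree with `|ψ⟩^{⊗m}` on all but `r` subsystems lie in the Hamming ball: the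
unitaries on the remaining subsystems span all operators, in particular `|w⟩⟨ψ|^{⊗ r}`. -/
lemma mem_hammingBall {d m r : ℕ} (ψ : PureState d) (T : Finset (Fin m)) (hT : m - r ≤ T.card)
    (w : ({i // i ∉ T} → Fin d) → ℂ) :
    (fun x : Word d m => (∏ i : {i // i ∈ T}, (ψ : EuclideanSpace ℂ (Fin d)) (x i)) *
      w (fun i => x i)) ∈ hammingBall r (tensorPow ψ m) := by
  let Φ : Matrix ({i // i ∉ T} → Fin d) ({i // i ∉ T} → Fin d) ℂ →ₗ[ℂ] (Word d m → ℂ) :=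
    { toFun := fun U => extendOp T U *ᵥ tensorPow ψ m
      map_add' := fun U V => by
        simp only [extendOp_mulVec_tensorPow, Matrix.add_mulVec]
        funext x
        simp only [Pi.add_apply]; ring
      map_smul' := fun c U => by
        simp only [extendOp_mulVec_tensorPow, Matrix.smul_mulVec]
        funext x
        simp only [Pi.smul_apply, smul_eq_mul, RingHom.id_apply]; ring }
  have hΦ : ∀ U, Φ U ∈ hammingBall r (tensorPow ψ m) := by
    open scoped Matrix.Norms.L2Operator in
    have hspan := CStarAlgebra.span_unitary
      (A := Matrix ({i // i ∉ T} → Fin d) ({i // i ∉ T} → Fin d) ℂ)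
    have hle : Submodule.span ℂ (unitary (Matrix ({i // i ∉ T} → Fin d) ({i // i ∉ T} → Fin d) ℂ) :
        Set _) ≤ (hammingBall r (tensorPow ψ m)).comap Φ := by
      refine Submodule.span_le.mpr fun U hU => Submodule.subset_span ⟨extendOp T U, ⟨?_, T, hT, ?_⟩, rfl⟩
      · exact extendOp_mem_unitaryGroup T U hU
      · exact actsTriviallyOn_extendOp T U
    intro U
    exact hle (hspan ▸ Submodule.mem_top)
  have h := hΦ (Matrix.vecMulVec w
    (star fun u => ∏ i, (ψ : EuclideanSpace ℂ (Fin d)) (u i)))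
  convert h using 1
  change _ = extendOp T _ *ᵥ _
  rw [extendOp_mulVec_tensorPow, Matrix.vecMulVec_mulVec]
  have h1 : (star fun u : {i // i ∉ T} → Fin d => ∏ i, (ψ : EuclideanSpace ℂ (Fin d)) (u i)) ⬝ᵥ
      (fun u => ∏ i, (ψ : EuclideanSpace ℂ (Fin d)) (u i)) = 1 := by
    rw [dotProduct_comm]
    exact sum_prod_mul_star _ ψ
  rw [h1]
  simp

/-! ### Projectors onto error patterns -/

/-- The product operator `A₁ ⊗ ⋯ ⊗ A_m`. -/
noncomputable def productOp {d m : ℕ} (A : Fin m → Matrix (Fin d) (Fin d) ℂ) : Op d m :=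
  Matrix.of fun x y => ∏ i, A i (x i) (y i)

section productOp
variable {d m : ℕ}

lemma productOp_mul (A B : Fin m → Matrix (Fin d) (Fin d) ℂ) :
    productOp A * productOp B = productOp fun i => A i * B i := by
  ext x z
  simp only [Matrix.mul_apply, productOp, Matrix.of_apply, ← Finset.prod_mul_distrib]
  have := Finset.prod_univ_sum (fun _ : Fin m => (Finset.univ : Finset (Fin d)))
    (fun i j => A i (x i) j * B i j (z i))
  rw [this, Fintype.piFinset_univ]

lemma conjTranspose_productOp (A : Fin m → Matrix (Fin d) (Fin d) ℂ) :
    (productOp A)ᴴ = productOp fun i => (A i)ᴴ := by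
  ext x y
  simp [productOp]

lemma productOp_one : productOp (fun _ : Fin m => (1 : Matrix (Fin d) (Fin d) ℂ)) = 1 := by
  ext x y
  simp only [productOp, Matrix.of_apply, Matrix.one_apply]
  rw [Finset.prod_ite_zero]
  simp [funext_iff]

lemma productOp_eq_zero {A : Fin m → Matrix (Fin d) (Fin d) ℂ} (i : Fin m) (h : A i = 0) :
    productOp A = 0 := by
  ext x y
  exact Finset.prod_eq_zero (Finset.mem_univ i) (by rw [h]; rfl)

end productOp

/-- The projector `|ψ⟩⟨ψ|` on `ℂ^d`. -/
noncomputable def pureProj {d : ℕ} (ψ : PureState d) : Matrix (Fin d) (Fin d) ℂ :=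
  Matrix.vecMulVec (ψ : EuclideanSpace ℂ (Fin d)) (star (ψ : EuclideanSpace ℂ (Fin d)).ofLp)

lemma pureProj_mul_self {d : ℕ} (ψ : PureState d) : pureProj ψ * pureProj ψ = pureProj ψ := by
  have h := star_dotProduct_self (ψ : EuclideanSpace ℂ (Fin d)).ofLp
  have h1 : l2norm (ψ : EuclideanSpace ℂ (Fin d)).ofLp = 1 := by simp [l2norm]
  rw [h1] at h
  rw [pureProj, Matrix.vecMulVec_mul_vecMulVec, h]
  simp

lemma conjTranspose_pureProj {d : ℕ} (ψ : PureState d) : (pureProj ψ)ᴴ = pureProj ψ := by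
  rw [pureProj, Matrix.conjTranspose_vecMulVec, star_star]

/-- The projector onto the vectors that are orthogonal to `|ψ⟩` on the subsystems in `S` and equal
to `|ψ⟩` on the others. -/
noncomputable def errorProj {d m : ℕ} (ψ : PureState d) (S : Finset (Fin m)) : Op d m :=
  productOp fun i => if i ∈ S then 1 - pureProj ψ else pureProj ψ

section errorProj
variable {d m : ℕ} (ψ : PureState d)

lemma errorProj_mul (S T : Finset (Fin m)) :
    errorProj ψ S * errorProj ψ T = if S = T then errorProj ψ S else 0 := by
  rw [errorProj, errorProj, productOp_mul]
  split_ifs with h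
  · subst h
    congr 1
    funext i
    split_ifs
    · rw [mul_sub, sub_mul, sub_mul, pureProj_mul_self]; simp
    · exact pureProj_mul_self ψ
  · obtain ⟨i, hi⟩ : ∃ i, ¬ (i ∈ S ↔ i ∈ T) := by
      by_contra! hc
      exact h (Finset.ext hc)
    refine productOp_eq_zero i ?_
    by_cases hS : i ∈ S
    · have hT : i ∉ T := fun hT => hi ⟨fun _ => hT, fun _ => hS⟩
      rw [if_pos hS, if_neg hT, sub_mul, pureProj_mul_self, one_mul, sub_self]
    · have hT : i ∈ T := by tauto
      rw [if_neg hS, if_pos hT, mul_sub, pureProj_mul_self, mul_one, sub_self]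

lemma conjTranspose_errorProj (S : Finset (Fin m)) : (errorProj ψ S)ᴴ = errorProj ψ S := by
  rw [errorProj, conjTranspose_productOp]
  congr 1
  funext i
  split_ifs <;> simp [conjTranspose_pureProj]

lemma sum_errorProj : ∑ S : Finset (Fin m), errorProj ψ S = 1 := by
  rw [← productOp_one]
  ext x y
  rw [Matrix.sum_apply]
  simp only [errorProj, productOp, Matrix.of_apply]
  have h := Fintype.prod_add (fun i => (1 - pureProj ψ) (x i) (y i))
    (fun i => pureProj ψ (x i) (y i))
  have h1 : ∀ i, (1 - pureProj ψ) (x i) (y i) + pureProj ψ (x i) (y i) =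
      (1 : Matrix (Fin d) (Fin d) ℂ) (x i) (y i) := fun i => by simp
  simp only [h1] at h
  rw [h]
  refine Finset.sum_congr rfl fun S _ => ?_
  rw [← Finset.prod_mul_prod_compl S]
  congr 1
  · exact Finset.prod_congr rfl fun i hi => by rw [if_pos hi]
  · exact Finset.prod_congr rfl fun i hi => by rw [if_neg (Finset.mem_compl.mp hi)]

lemma l2norm_sum_errorProj_sq (F : Finset (Finset (Fin m))) (v : Word d m → ℂ) :
    l2norm ((∑ S ∈ F, errorProj ψ S) *ᵥ v) ^ 2 = ∑ S ∈ F, l2norm (errorProj ψ S *ᵥ v) ^ 2 := by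
  have key : ∀ F : Finset (Finset (Fin m)),
      star ((∑ S ∈ F, errorProj ψ S) *ᵥ v) ⬝ᵥ ((∑ S ∈ F, errorProj ψ S) *ᵥ v) =
        ∑ S ∈ F, star v ⬝ᵥ (errorProj ψ S *ᵥ v) := by
    intro F
    rw [Matrix.star_mulVec, ← Matrix.dotProduct_mulVec, Matrix.mulVec_mulVec,
      Matrix.conjTranspose_sum]
    simp only [conjTranspose_errorProj, Finset.sum_mul_sum, errorProj_mul]
    have : ∑ S ∈ F, ∑ T ∈ F, (if S = T then errorProj ψ S else 0) = ∑ S ∈ F, errorProj ψ S := by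
      refine Finset.sum_congr rfl fun S hS => ?_
      rw [Finset.sum_ite_eq, if_pos hS]
    rw [this, Matrix.sum_mulVec, dotProduct_sum]
  have h1 := key F
  have h2 : ∀ S, star v ⬝ᵥ (errorProj ψ S *ᵥ v) = ((l2norm (errorProj ψ S *ᵥ v) ^ 2 : ℝ) : ℂ) := by
    intro S
    have := key {S}
    rw [Finset.sum_singleton, Finset.sum_singleton, star_dotProduct_self] at this
    exact this.symm
  simp only [h2] at h1
  rw [star_dotProduct_self] at h1
  exact_mod_cast h1

lemma sum_l2norm_errorProj_sq (v : Word d m → ℂ) :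
    ∑ S : Finset (Fin m), l2norm (errorProj ψ S *ᵥ v) ^ 2 = l2norm v ^ 2 := by
  rw [← l2norm_sum_errorProj_sq, sum_errorProj, Matrix.one_mulVec]

lemma errorProj_map (S : Finset (Fin m)) (σ : Equiv.Perm (Fin m)) (x y : Word d m) :
    errorProj ψ (S.map σ.toEmbedding) x y = errorProj ψ S (x ∘ σ) (y ∘ σ) := by
  simp only [errorProj, productOp, Matrix.of_apply]
  rw [← Equiv.prod_comp σ]
  refine Finset.prod_congr rfl fun i _ => ?_
  simp

lemma l2norm_errorProj_map (S : Finset (Fin m)) (σ : Equiv.Perm (Fin m)) {v : Word d m → ℂ}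
    (hv : v ∈ symmetricSubspace d m) :
    l2norm (errorProj ψ (S.map σ.toEmbedding) *ᵥ v) ^ 2 = l2norm (errorProj ψ S *ᵥ v) ^ 2 := by
  have h : ∀ x, (errorProj ψ (S.map σ.toEmbedding) *ᵥ v) x = (errorProj ψ S *ᵥ v) (x ∘ σ) := by
    intro x
    simp only [Matrix.mulVec, dotProduct, errorProj_map]
    refine Fintype.sum_equiv (Equiv.arrowCongr σ.symm (Equiv.refl _)) _ _ fun y => ?_
    have : (Equiv.arrowCongr σ.symm (Equiv.refl (Fin d))) y = y ∘ σ := by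
      funext i; simp [Equiv.arrowCongr]
    rw [this, hv σ y]
  rw [l2norm_sq, l2norm_sq]
  simp only [h]
  refine Fintype.sum_equiv (Equiv.arrowCongr σ.symm (Equiv.refl _)) _ _ fun y => ?_
  congr 2

/-- On a symmetric vector the weight of an error pattern depends on the number of errors only. -/
lemma l2norm_errorProj_eq_of_card_eq {S T : Finset (Fin m)} (h : S.card = T.card)
    {v : Word d m → ℂ} (hv : v ∈ symmetricSubspace d m) :
    l2norm (errorProj ψ S *ᵥ v) ^ 2 = l2norm (errorProj ψ T *ᵥ v) ^ 2 := by
  have e : {i // i ∈ S} ≃ {i // i ∈ T} := Fintype.equivOfCardEq (by simpa using h)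
  have hT : T = S.map e.extendSubtype.toEmbedding := by
    symm
    refine Finset.eq_of_subset_of_card_le (fun j hj => ?_) (by simp [h])
    obtain ⟨i, hi, rfl⟩ := Finset.mem_map.mp hj
    exact e.extendSubtype_mem i hi
  rw [hT, l2norm_errorProj_map ψ S _ hv]

/-- The image of `errorProj ψ S` consists of vectors that differ from `|ψ⟩^{⊗m}` on `S` only. -/
lemma errorProj_mulVec_mem_hammingBall {r : ℕ} {S : Finset (Fin m)} (hS : S.card ≤ r)
    (v : Word d m → ℂ) : errorProj ψ S *ᵥ v ∈ hammingBall r (tensorPow ψ m) := by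
  have hcard : m - r ≤ Sᶜ.card := by
    rw [Finset.card_compl, Fintype.card_fin]; omega
  convert mem_hammingBall ψ Sᶜ hcard (fun u => ∑ y : Word d m,
    (∏ i : {i // i ∉ Sᶜ}, (1 - pureProj ψ) (u i) (y i)) *
      (∏ i : {i // i ∈ Sᶜ}, star ((ψ : EuclideanSpace ℂ (Fin d)) (y i))) * v y) using 1
  funext x
  rw [Matrix.mulVec, dotProduct, Finset.mul_sum]
  refine Finset.sum_congr rfl fun y _ => ?_
  rw [errorProj, productOp, Matrix.of_apply, ← Fintype.prod_subtype_mul_prod_subtype (· ∈ Sᶜ)]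
  have h1 : ∀ i : {i // i ∈ Sᶜ}, (if (i : Fin m) ∈ S then 1 - pureProj ψ else pureProj ψ)
      (x i) (y i) = (ψ : EuclideanSpace ℂ (Fin d)) (x i) *
        star ((ψ : EuclideanSpace ℂ (Fin d)) (y i)) := fun i => by
    rw [if_neg (Finset.mem_compl.mp i.2)]; rfl
  have h2 : ∀ i : {i // i ∉ Sᶜ}, (if (i : Fin m) ∈ S then 1 - pureProj ψ else pureProj ψ)
      (x i) (y i) = (1 - pureProj ψ) (x i) (y i) := fun i => by
    rw [if_pos (by simpa using i.2)]
  simp only [h1, h2, Finset.prod_mul_distrib]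
  have h3 : ∀ a b c e : ℂ, a * b * c * e = a * (c * b * e) := fun a b c e => by ring
  rw [h3]
  congr!

end errorProj

/-! ### Errors of a partially contracted symmetric vector -/

/-- The partial contraction `(𝕀 ⊗ ⟨ψ|^{⊗k}) v`. -/
noncomputable def contractPow {d n k : ℕ} (ψ : PureState d) (v : Word d (n + k) → ℂ) : Word d n → ℂ :=
  fun x => ∑ z : Word d k, v (Fin.append x z) * star (tensorPow ψ k z)

lemma sum_word_append {d n k : ℕ} {M : Type*} [AddCommMonoid M] (f : Word d (n + k) → M) :
    ∑ y, f y = ∑ x : Word d n, ∑ z : Word d k, f (Fin.append x z) := by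
  rw [← (Fin.appendEquiv n k).sum_comp, Fintype.sum_prod_type]
  rfl

section contractPow
variable {d n k : ℕ} (ψ : PureState d)

lemma errorProj_append (S : Finset (Fin n)) (x y : Word d n) (z w : Word d k) :
    errorProj ψ (S.map (Fin.castAddEmb k)) (Fin.append x z) (Fin.append y w) =
      errorProj ψ S x y * (tensorPow ψ k z * star (tensorPow ψ k w)) := by
  simp only [errorProj, productOp, Matrix.of_apply, Fin.prod_univ_add, Fin.append_left,
    Fin.append_right, tensorPow, star_prod, ← Finset.prod_mul_distrib]
  congr 1
  · refine Finset.prod_congr rfl fun i _ => ?_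
    have : (Fin.castAdd k i ∈ S.map (Fin.castAddEmb k)) ↔ i ∈ S := by
      rw [← Fin.coe_castAddEmb, Finset.mem_map']
    simp only [this]
  · refine Finset.prod_congr rfl fun i _ => ?_
    have : Fin.natAdd n i ∉ S.map (Fin.castAddEmb k) := by
      intro h
      obtain ⟨j, _, hj⟩ := Finset.mem_map.mp h
      have := congrArg Fin.val hj
      simp at this
      omega
    rw [if_neg this]
    rfl

/-- An error pattern of the contracted vector is the same pattern of the original vector, without
errors on the contracted subsystems. -/
lemma l2norm_errorProj_contractPow_sq (S : Finset (Fin n)) (v : Word d (n + k) → ℂ) :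
    l2norm (errorProj ψ S *ᵥ contractPow ψ v) ^ 2 =
      l2norm (errorProj ψ (S.map (Fin.castAddEmb k)) *ᵥ v) ^ 2 := by
  have h : ∀ x z, (errorProj ψ (S.map (Fin.castAddEmb k)) *ᵥ v) (Fin.append x z) =
      (errorProj ψ S *ᵥ contractPow ψ v) x * tensorPow ψ k z := by
    intro x z
    rw [Matrix.mulVec, dotProduct, sum_word_append]
    simp only [errorProj_append, Matrix.mulVec, dotProduct, contractPow, Finset.mul_sum,
      Finset.sum_mul]
    refine Finset.sum_congr rfl fun y _ => Finset.sum_congr rfl fun w _ => ?_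
    ring
  have h1 : ∑ z : Word d k, ‖tensorPow ψ k z‖ ^ 2 = 1 := by
    have := sum_tensorPow_mul_star (k := k) ψ
    have h4 : ∀ z : ℂ, z * star z = ((‖z‖ ^ 2 : ℝ) : ℂ) := fun z => by
      rw [Complex.star_def, Complex.mul_conj, Complex.normSq_eq_norm_sq]
    simp only [h4] at this
    exact_mod_cast this
  rw [l2norm_sq, l2norm_sq, sum_word_append]
  simp only [h, norm_mul, mul_pow, ← Finset.mul_sum, h1, mul_one]

lemma l2norm_contractPow_le (v : Word d (n + k) → ℂ) : l2norm (contractPow ψ v) ≤ l2norm v := by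
  refine (abs_le_of_sq_le_sq' ?_ (l2norm_nonneg v)).2
  rw [← sum_l2norm_errorProj_sq ψ, ← sum_l2norm_errorProj_sq ψ v]
  simp only [l2norm_errorProj_contractPow_sq]
  calc _ = ∑ T ∈ Finset.univ.map (Finset.mapEmbedding (Fin.castAddEmb k)).toEmbedding,
        l2norm (errorProj ψ T *ᵥ v) ^ 2 := by
        rw [Finset.sum_map]; rfl
    _ ≤ _ := Finset.sum_le_sum_of_subset_of_nonneg (Finset.subset_univ _)
        fun _ _ _ => sq_nonneg _

end contractPow

/-! ### Hypergeometric tails -/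

lemma descFactorial_mul_pow_le {n m : ℕ} (h : n ≤ m) (j : ℕ) :
    n.descFactorial j * m ^ j ≤ n ^ j * m.descFactorial j := by
  induction j with
  | zero => simp
  | succ j ih =>
    have h1 : (n - j) * m ≤ n * (m - j) := by
      rw [Nat.sub_mul, Nat.mul_sub]
      refine Nat.sub_le_sub_left ?_ _
      rw [mul_comm]
      exact Nat.mul_le_mul_left j h
    calc n.descFactorial (j + 1) * m ^ (j + 1)
        = ((n - j) * m) * (n.descFactorial j * m ^ j) := by
          rw [Nat.descFactorial_succ, pow_succ]; ring
      _ ≤ (n * (m - j)) * (n ^ j * m.descFactorial j) := Nat.mul_le_mul h1 ih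
      _ = _ := by rw [Nat.descFactorial_succ, pow_succ]; ring

lemma choose_mul_pow_le {n m : ℕ} (h : n ≤ m) (j : ℕ) :
    n.choose j * m ^ j ≤ n ^ j * m.choose j := by
  have := descFactorial_mul_pow_le h j
  rw [Nat.descFactorial_eq_factorial_mul_choose, Nat.descFactorial_eq_factorial_mul_choose] at this
  refine Nat.le_of_mul_le_mul_left ?_ (Nat.factorial_pos j)
  linarith

/-- If a set of errors among `m` positions is weighted by its size only, then more than `r` errors,
all of them in the first `n` positions, carry at most the fraction `(n / m) ^ r` of the weight. -/
lemma sum_card_gt_le {n m : ℕ} (hn : 1 ≤ n) (hnm : n ≤ m) (r : ℕ) (g : ℕ → ℝ) (hg : ∀ j, 0 ≤ g j) :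
    ∑ S : Finset (Fin n) with r < S.card, g S.card ≤
      ((n : ℝ) / m) ^ r * ∑ T : Finset (Fin m), g T.card := by
  have hm : (0 : ℝ) < m := by exact_mod_cast (by omega : 0 < m)
  have hq1 : (n : ℝ) / m ≤ 1 := (div_le_one hm).mpr (by exact_mod_cast hnm)
  have hq0 : 0 ≤ (n : ℝ) / m := by positivity
  rw [Finset.sum_filter, ← Finset.powerset_univ, ← Finset.powerset_univ,
    Finset.sum_powerset_apply_card (fun j => if r < j then g j else 0),
    Finset.sum_powerset_apply_card g, Finset.mul_sum, Finset.card_univ, Finset.card_univ,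
    Fintype.card_fin, Fintype.card_fin]
  calc _ ≤ ∑ j ∈ Finset.range (n + 1), ((n : ℝ) / m) ^ r * (m.choose j • g j) := by
        refine Finset.sum_le_sum fun j _ => ?_
        simp only [nsmul_eq_mul]
        split_ifs with h
        · rw [← mul_assoc]
          refine mul_le_mul_of_nonneg_right ?_ (hg j)
          calc (n.choose j : ℝ) ≤ ((n : ℝ) / m) ^ j * m.choose j := by
                rw [div_pow, div_mul_eq_mul_div, le_div_iff₀ (by positivity)]
                exact_mod_cast choose_mul_pow_le hnm j
            _ ≤ _ := mul_le_mul_of_nonneg_right (pow_le_pow_of_le_one hq0 hq1 h.le)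
                (Nat.cast_nonneg _)
        · rw [mul_zero]
          have := hg j
          positivity
    _ ≤ _ := by
        refine Finset.sum_le_sum_of_subset_of_nonneg
          (Finset.range_subset_range.mpr (by omega)) fun j _ _ => ?_
        have := hg j
        simp only [nsmul_eq_mul]
        positivity

lemma div_pow_le_exp {n k : ℕ} (hn : 1 ≤ n) (r : ℕ) :
    ((n : ℝ) / (n + k : ℕ)) ^ r ≤ Real.exp (-((r : ℝ) / 6) * min ((k : ℝ) / n) 1) ^ 2 := by
  have hn' : (0 : ℝ) < n := by exact_mod_cast hn
  set t := min ((k : ℝ) / n) 1 with ht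
  have ht0 : 0 ≤ t := le_min (by positivity) zero_le_one
  have ht1 : t ≤ 1 := min_le_right _ _
  have ht2 : t * n ≤ k := (le_div_iff₀ hn').mp (min_le_left _ _)
  have h1 : (n : ℝ) / (n + k : ℕ) ≤ Real.exp (-(t / 3)) := by
    refine le_trans ?_ (Real.one_sub_le_exp_neg _)
    push_cast
    rw [div_le_iff₀ (by positivity)]
    have h3 : 0 ≤ t * (1 - t) * n := by
      have := sub_nonneg.mpr ht1
      positivity
    nlinarith [mul_nonneg (by linarith : (0 : ℝ) ≤ 1 - t / 3) (sub_nonneg.mpr ht2), mul_nonneg ht0 hn'.le]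
  calc _ ≤ Real.exp (-(t / 3)) ^ r := pow_le_pow_left₀ (by positivity) h1 r
    _ = _ := by
      rw [← Real.exp_nat_mul, ← Real.exp_nat_mul]
      congr 1
      push_cast; ring

/-! ### The component with few errors -/

/-- The projector onto the span of the vectors with at most `r` subsystems orthogonal to `|ψ⟩`. -/
noncomputable def fewErrorsProj {d m : ℕ} (r : ℕ) (ψ : PureState d) : Op d m :=
  ∑ S : Finset (Fin m) with S.card ≤ r, errorProj ψ S

section fewErrorsProj
variable {d n k : ℕ} (r : ℕ) (ψ : PureState d)

lemma sub_fewErrorsProj_mulVec (a : Word d n → ℂ) : a - fewErrorsProj r ψ *ᵥ a =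
    (∑ S : Finset (Fin n) with r < S.card, errorProj ψ S) *ᵥ a := by
  have h : (fewErrorsProj r ψ : Op d n) + ∑ S : Finset (Fin n) with r < S.card, errorProj ψ S = 1 := by
    rw [← sum_errorProj ψ, fewErrorsProj,
      ← Finset.sum_filter_add_sum_filter_not Finset.univ (fun S : Finset (Fin n) => S.card ≤ r)]
    simp only [not_le]
  rw [sub_eq_iff_eq_add, ← Matrix.add_mulVec, add_comm, h, Matrix.one_mulVec]

lemma l2norm_fewErrorsProj_sq_add (a : Word d n → ℂ) :
    l2norm (fewErrorsProj r ψ *ᵥ a) ^ 2 + l2norm (a - fewErrorsProj r ψ *ᵥ a) ^ 2 =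
      l2norm a ^ 2 := by
  rw [sub_fewErrorsProj_mulVec, fewErrorsProj, l2norm_sum_errorProj_sq, l2norm_sum_errorProj_sq,
    ← sum_l2norm_errorProj_sq ψ a,
    ← Finset.sum_filter_add_sum_filter_not Finset.univ (fun S : Finset (Fin n) => S.card ≤ r)]
  simp only [not_le]

lemma fewErrorsProj_mulVec_mem_hammingBall (a : Word d n → ℂ) :
    fewErrorsProj r ψ *ᵥ a ∈ hammingBall r (tensorPow ψ n) := by
  rw [fewErrorsProj, Matrix.sum_mulVec]
  exact Submodule.sum_mem _ fun S hS =>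
    errorProj_mulVec_mem_hammingBall ψ (Finset.mem_filter.mp hS).2 a

/-- After contraction with `|ψ⟩^{⊗k}`, a symmetric vector has exponentially small weight on more than
`r` errors, since errors are evenly spread and none may fall on the last `k` subsystems. -/
lemma l2norm_sub_fewErrorsProj_contractPow_le (hn : 1 ≤ n) {v : Word d (n + k) → ℂ}
    (hv : v ∈ symmetricSubspace d (n + k)) (hv1 : l2norm v = 1) :
    l2norm (contractPow ψ v - fewErrorsProj r ψ *ᵥ contractPow ψ v) ≤
      Real.exp (-((r : ℝ) / 6) * min ((k : ℝ) / n) 1) := by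
  classical
  refine (abs_le_of_sq_le_sq' ?_ (Real.exp_nonneg _)).2
  refine le_trans ?_ (div_pow_le_exp (k := k) hn r)
  let g : ℕ → ℝ := fun j => if h : ∃ T : Finset (Fin (n + k)), T.card = j then
    l2norm (errorProj ψ h.choose *ᵥ v) ^ 2 else 0
  have hg : ∀ T : Finset (Fin (n + k)), l2norm (errorProj ψ T *ᵥ v) ^ 2 = g T.card := by
    intro T
    have h : ∃ T' : Finset (Fin (n + k)), T'.card = T.card := ⟨T, rfl⟩
    simp only [g, dif_pos h]
    exact l2norm_errorProj_eq_of_card_eq ψ h.choose_spec.symm hv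
  have hg0 : ∀ j, 0 ≤ g j := by
    intro j
    simp only [g]
    split_ifs
    · exact sq_nonneg _
    · exact le_rfl
  have h := sum_card_gt_le hn (Nat.le_add_right n k) r g hg0
  rw [sub_fewErrorsProj_mulVec, l2norm_sum_errorProj_sq]
  simp only [l2norm_errorProj_contractPow_sq, hg, Finset.card_map]
  refine h.trans_eq ?_
  simp only [← hg]
  rw [sum_l2norm_errorProj_sq, hv1]
  simp

end fewErrorsProj

/-- Replacing a vector `a = b + e` by the normalization `t` of its component `b`, at equal weight,
changes the expectation value of a contraction by `O(‖e‖ ‖a‖)`. -/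
lemma norm_expectation_sub_le {ι : Type*} [Fintype ι] {W : Matrix ι ι ℂ}
    (hW : ∀ x y : ι → ℂ, ‖star x ⬝ᵥ (W *ᵥ y)‖ ≤ l2norm x * l2norm y) {a b e t : ι → ℂ}
    (ha : a = b + e) (hsq : l2norm b ^ 2 + l2norm e ^ 2 = l2norm a ^ 2) (ht : l2norm t = 1)
    (hb : b = (l2norm b : ℂ) • t) :
    ‖star a ⬝ᵥ (W *ᵥ a) - (l2norm a : ℂ) ^ 2 * (star t ⬝ᵥ (W *ᵥ t))‖ ≤
      3 * (l2norm e * l2norm a) := by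
  have hbb : star b ⬝ᵥ (W *ᵥ b) = (l2norm b : ℂ) ^ 2 * (star t ⬝ᵥ (W *ᵥ t)) := by
    conv_lhs => rw [hb]
    rw [Matrix.mulVec_smul, star_smul, smul_dotProduct, dotProduct_smul, Complex.star_def,
      Complex.conj_ofReal, smul_eq_mul, smul_eq_mul]
    ring
  have hsq' : (l2norm b : ℂ) ^ 2 + (l2norm e : ℂ) ^ 2 = (l2norm a : ℂ) ^ 2 := by exact_mod_cast hsq
  have hab : star a ⬝ᵥ (W *ᵥ a) = star e ⬝ᵥ (W *ᵥ a) + star b ⬝ᵥ (W *ᵥ e) + star b ⬝ᵥ (W *ᵥ b) := by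
    have h1 : star a ⬝ᵥ (W *ᵥ a) = star b ⬝ᵥ (W *ᵥ a) + star e ⬝ᵥ (W *ᵥ a) := by
      conv_lhs => rw [show star a = star b + star e by rw [ha, star_add]]
      rw [add_dotProduct]
    have h2 : star b ⬝ᵥ (W *ᵥ a) = star b ⬝ᵥ (W *ᵥ b) + star b ⬝ᵥ (W *ᵥ e) := by
      rw [ha, Matrix.mulVec_add, dotProduct_add]
    rw [h1, h2]; ring
  have hexp : star a ⬝ᵥ (W *ᵥ a) - (l2norm a : ℂ) ^ 2 * (star t ⬝ᵥ (W *ᵥ t)) =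
      star e ⬝ᵥ (W *ᵥ a) + star b ⬝ᵥ (W *ᵥ e) - (l2norm e : ℂ) ^ 2 * (star t ⬝ᵥ (W *ᵥ t)) := by
    rw [hab, hbb, ← hsq']; ring
  have hba : l2norm b ≤ l2norm a :=
    (abs_le_of_sq_le_sq' (by nlinarith [sq_nonneg (l2norm e)]) (l2norm_nonneg a)).2
  have hea : l2norm e ≤ l2norm a :=
    (abs_le_of_sq_le_sq' (by nlinarith [sq_nonneg (l2norm b)]) (l2norm_nonneg a)).2
  have he := l2norm_nonneg e
  have h3 : ‖(l2norm e : ℂ) ^ 2 * (star t ⬝ᵥ (W *ᵥ t))‖ ≤ l2norm e * l2norm a := by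
    rw [norm_mul, norm_pow, Complex.norm_real, Real.norm_of_nonneg he]
    have := hW t t
    rw [ht, one_mul] at this
    calc _ ≤ l2norm e ^ 2 * 1 := by gcongr
      _ ≤ _ := by rw [mul_one, sq]; gcongr
  have h4 : ‖star b ⬝ᵥ (W *ᵥ e)‖ ≤ l2norm e * l2norm a :=
    (hW b e).trans (by rw [mul_comm]; gcongr)
  rw [hexp]
  refine (norm_sub_le _ _).trans ?_
  linarith [norm_add_le (star e ⬝ᵥ (W *ᵥ a)) (star b ⬝ᵥ (W *ᵥ e)), hW e a]

/-! ### Mixtures and the de Finetti measure -/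

lemma isDensity_vecMulVec {d m : ℕ} {t : Word d m → ℂ} (ht : l2norm t = 1) :
    IsDensity (Matrix.vecMulVec t (star t)) := by
  refine ⟨Matrix.posSemidef_vecMulVec_self_star t, ?_⟩
  rw [Matrix.trace_vecMulVec, dotProduct_comm, star_dotProduct_self, ht]
  simp

lemma quantumHammingDist_vecMulVec_le {d m r : ℕ} (hr : r ≤ m) {t φ : Word d m → ℂ}
    (ht : t ∈ hammingBall r φ) : quantumHammingDist (Matrix.vecMulVec t (star t)) φ ≤ r := by
  refine iInf₂_le r ⟨hr, ?_⟩
  rintro _ ⟨u, rfl⟩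
  rw [Matrix.mulVecLin_apply, Matrix.vecMulVec_mulVec]
  rw [op_smul_eq_smul]
  exact Submodule.smul_mem (hammingBall r φ) _ ht

lemma norm_apply_le_l2norm {ι : Type*} [Fintype ι] (t : ι → ℂ) (i : ι) : ‖t i‖ ≤ l2norm t :=
  PiLp.norm_apply_le (WithLp.toLp 2 t : EuclideanSpace ℂ ι) i

lemma continuous_l2norm {ι : Type*} [Fintype ι] : Continuous (l2norm : (ι → ℂ) → ℝ) :=
  continuous_norm.comp (PiLp.continuous_toLp 2 _)

section mixture
variable {d n : ℕ} (ν : Measure (PureState d)) [IsFiniteMeasure ν]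

lemma integrable_vecMulVec_apply {t : PureState d → Word d n → ℂ} (htm : Measurable t)
    (ht : ∀ ψ, l2norm (t ψ) = 1) (x y : Word d n) :
    Integrable (fun ψ => Matrix.vecMulVec (t ψ) (star (t ψ)) x y) ν := by
  refine Integrable.of_bound (C := 1) ?_ (Filter.Eventually.of_forall fun ψ => ?_)
  · simp only [Matrix.vecMulVec_apply, Pi.star_apply]
    have h := fun x : Word d n => (measurable_pi_apply x).comp htm
    exact ((h x).mul (continuous_star.measurable.comp (h y))).aestronglyMeasurable
  · rw [Matrix.vecMulVec_apply, Pi.star_apply, norm_mul, norm_star]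
    have h := fun x => (norm_apply_le_l2norm (t ψ) x).trans_eq (ht ψ)
    exact mul_le_one₀ (h x) (norm_nonneg _) (h y)

lemma trace_mul_mixture {t : PureState d → Word d n → ℂ} (htm : Measurable t)
    (ht : ∀ ψ, l2norm (t ψ) = 1) (W : Op d n) :
    (W * mixture ν fun ψ => Matrix.vecMulVec (t ψ) (star (t ψ))).trace =
      ∫ ψ, star (t ψ) ⬝ᵥ (W *ᵥ t ψ) ∂ν := by
  have htr : ∀ M : Op d n, (W * M).trace = ∑ x, ∑ y, W x y * M y x := fun M => rfl
  have hi := integrable_vecMulVec_apply ν htm ht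
  simp only [← Matrix.trace_mul_vecMulVec_star, htr]
  rw [integral_finsetSum _ fun x _ => integrable_finsetSum _ fun y _ => (hi y x).const_mul (W x y)]
  refine Finset.sum_congr rfl fun x _ => ?_
  rw [integral_finsetSum _ fun y _ => (hi y x).const_mul (W x y)]
  refine Finset.sum_congr rfl fun y _ => ?_
  rw [integral_const_mul]
  rfl

end mixture

section pure
variable {d n k : ℕ} (v : Word d (n + k) → ℂ)

lemma trace_tensorOp_mul_vecMulVec (ψ : PureState d) :
    (tensorOp (1 : Op d n) (projPow ψ k) * Matrix.vecMulVec v (star v)).trace =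
      ((l2norm (contractPow ψ v) ^ 2 : ℝ) : ℂ) := by
  rw [Matrix.trace_mul_vecMulVec_star, ← star_dotProduct_self, dotProduct, dotProduct,
    sum_word_append]
  refine Finset.sum_congr rfl fun x _ => ?_
  have h : ∀ z, (tensorOp (1 : Op d n) (projPow ψ k) *ᵥ v) (Fin.append x z) =
      tensorPow ψ k z * contractPow ψ v x := by
    intro z
    rw [Matrix.mulVec, dotProduct, sum_word_append]
    have h1 : ∀ (y : Word d n) (w : Word d k),
        tensorOp (1 : Op d n) (projPow ψ k) (Fin.append x z) (Fin.append y w) =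
          (1 : Op d n) x y * (tensorPow ψ k z * star (tensorPow ψ k w)) := by
      intro y w
      have h2 : ∀ (x : Word d n) (z : Word d k), (Fin.appendEquiv n k).symm (Fin.append x z) = (x, z) :=
        fun x z => (Fin.appendEquiv n k).symm_apply_apply (x, z)
      rw [tensorOp, Matrix.reindex_apply, Matrix.submatrix_apply, h2, h2,
        Matrix.kroneckerMap_apply]
      rfl
    simp only [h1, mul_assoc, ← Finset.mul_sum]
    simp only [Matrix.one_apply, ite_mul, one_mul, zero_mul]
    rw [Finset.sum_ite_eq, if_pos (Finset.mem_univ x), contractPow]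
    congr 1
    exact Finset.sum_congr rfl fun w _ => mul_comm _ _
  simp only [h, Pi.star_apply, contractPow, star_sum, star_mul', star_star, Finset.sum_mul]
  exact Finset.sum_congr rfl fun z _ => by ring

lemma continuous_contractPow : Continuous fun ψ : PureState d => contractPow ψ v := by
  refine continuous_pi fun x => continuous_finsetSum _ fun z _ => ?_
  exact continuous_const.mul (continuous_tensorPow z).star

lemma continuous_fewErrorsProj_mulVec (r : ℕ) {a : PureState d → Word d n → ℂ}
    (ha : Continuous a) : Continuous fun ψ => fewErrorsProj r ψ *ᵥ a ψ := by
  refine Continuous.matrix_mulVec ?_ ha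
  unfold fewErrorsProj
  refine continuous_finsetSum _ fun S _ => continuous_pi fun x => continuous_pi fun y => ?_
  simp only [errorProj, productOp, Matrix.of_apply]
  refine continuous_finsetProd _ fun i _ => ?_
  have h : Continuous fun ψ : PureState d => pureProj ψ (x i) (y i) := by
    simp only [pureProj, Matrix.vecMulVec_apply, Pi.star_apply]
    fun_prop
  split_ifs
  · simp only [Matrix.sub_apply]
    exact continuous_const.sub h
  · exact h

/-- A symmetric vector has its reduced state on the first `n` subsystems decomposed into contracted
vectors, as `|ψ⟩⟨ψ|^{⊗k}` averages to a multiple of the identity on the symmetric subspace. -/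
lemma integral_contractPow_mul_star {N : ℕ}
    (hN : ∀ w z : Word d k, ∫ ψ, tensorPow ψ k w * star (tensorPow ψ k z) ∂haarPure d =
        (permCount w z : ℂ) / (N * k.factorial)) [IsFiniteMeasure (haarPure d)]
    (hv : v ∈ symmetricSubspace d (n + k)) (x y : Word d n) :
    ∫ ψ, contractPow ψ v x * star (contractPow ψ v y) ∂haarPure d =
      partialTraceLast n k (Matrix.vecMulVec v (star v)) x y / N := by
  have hsymm : ∀ (σ : Equiv.Perm (Fin k)) (w : Word d k),
      v (Fin.append x (w ∘ σ)) = v (Fin.append x w) := by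
    intro σ w
    rw [← hv (finSumFinEquiv.permCongr (Equiv.Perm.sumCongr 1 σ)) (Fin.append x w)]
    congr 1
    funext i
    refine Fin.addCases (fun i => ?_) (fun i => ?_) i <;> simp [Equiv.permCongr_apply]
  have hint : ∀ w z : Word d k,
      Integrable (fun ψ => tensorPow ψ k w * star (tensorPow ψ k z)) (haarPure d) := fun w z =>
    Continuous.integrable_of_hasCompactSupport
      ((continuous_tensorPow w).mul (continuous_tensorPow z).star)
      (HasCompactSupport.of_compactSpace _)
  have h1 : ∀ ψ : PureState d, contractPow ψ v x * star (contractPow ψ v y) =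
      ∑ z, ∑ w, (v (Fin.append x z) * star (v (Fin.append y w))) *
        (tensorPow ψ k w * star (tensorPow ψ k z)) := by
    intro ψ
    simp only [contractPow, star_sum, Finset.sum_mul_sum]
    refine Finset.sum_congr rfl fun z _ => Finset.sum_congr rfl fun w _ => ?_
    rw [star_mul', star_star]; ring
  simp only [h1]
  rw [integral_finsetSum _ fun z _ => integrable_finsetSum _ fun w _ => (hint w z).const_mul _]
  simp only [fun z => integral_finsetSum (μ := haarPure d) Finset.univ
    (f := fun w ψ => (v (Fin.append x z) * star (v (Fin.append y w))) *
        (tensorPow ψ k w * star (tensorPow ψ k z))) fun w _ => (hint w z).const_mul _]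
  simp only [integral_const_mul, hN]
  have hk : (k.factorial : ℂ) ≠ 0 := Nat.cast_ne_zero.mpr (Nat.factorial_ne_zero k)
  have h2 : ∀ w : Word d k, ∑ z, v (Fin.append x z) * (permCount w z : ℂ) =
      k.factorial * v (Fin.append x w) := by
    intro w
    simp only [permCount, Nat.cast_sum, Nat.cast_ite, Nat.cast_one, Nat.cast_zero, Finset.mul_sum]
    rw [Finset.sum_comm]
    simp only [mul_ite, mul_one, mul_zero, Finset.sum_ite_eq, Finset.mem_univ, if_true, hsymm]
    simp [Fintype.card_perm]
  rw [Finset.sum_comm]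
  have h3 : ∀ w : Word d k, ∑ z, v (Fin.append x z) * star (v (Fin.append y w)) *
      ((permCount w z : ℂ) / (N * k.factorial)) =
      v (Fin.append x w) * star (v (Fin.append y w)) / N := by
    intro w
    calc _ = (∑ z, v (Fin.append x z) * (permCount w z : ℂ)) *
          (star (v (Fin.append y w)) / (N * k.factorial)) := by
          rw [Finset.sum_mul]
          exact Finset.sum_congr rfl fun z _ => by ring
      _ = _ := by
          rw [h2, div_mul_eq_div_div_swap]
          field_simp
  simp only [h3, ← Finset.sum_div]
  rfl

lemma trace_partialTraceLast (ρ : Op d (n + k)) : (partialTraceLast n k ρ).trace = ρ.trace := by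
  rw [Matrix.trace, Matrix.trace, sum_word_append]
  rfl

lemma weightedHaar_vecMulVec : weightedHaar n k (Matrix.vecMulVec v (star v)) =
    (haarPure d).withDensity fun ψ => ENNReal.ofReal (l2norm (contractPow ψ v) ^ 2) := by
  simp only [weightedHaar, trace_tensorOp_mul_vecMulVec, Complex.ofReal_re]

lemma trace_vecMulVec_star (hv1 : l2norm v = 1) : (Matrix.vecMulVec v (star v)).trace = 1 := by
  rw [Matrix.trace_vecMulVec, dotProduct_comm, star_dotProduct_self, hv1]; simp

lemma integrable_l2norm_contractPow_sq [IsFiniteMeasure (haarPure d)] :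
    Integrable (fun ψ => l2norm (contractPow ψ v) ^ 2) (haarPure d) :=
  Continuous.integrable_of_hasCompactSupport
    ((continuous_l2norm.comp (continuous_contractPow v)).pow 2) (HasCompactSupport.of_compactSpace _)

lemma integral_l2norm_contractPow_sq {N : ℕ}
    (hN : ∀ w z : Word d k, ∫ ψ, tensorPow ψ k w * star (tensorPow ψ k z) ∂haarPure d =
        (permCount w z : ℂ) / (N * k.factorial)) [IsFiniteMeasure (haarPure d)]
    (hv : v ∈ symmetricSubspace d (n + k)) (hv1 : l2norm v = 1) :
    ∫ ψ, l2norm (contractPow ψ v) ^ 2 ∂haarPure d = (N : ℝ)⁻¹ := by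
  have hc := continuous_pi_iff.mp (continuous_contractPow v (n := n) (k := k))
  have h : ((∫ ψ, l2norm (contractPow ψ v) ^ 2 ∂haarPure d : ℝ) : ℂ) = ((N : ℝ)⁻¹ : ℝ) := by
    rw [← integral_complex_ofReal]
    simp only [← star_dotProduct_self, dotProduct, Pi.star_apply, mul_comm (star _)]
    have hi : ∀ x : Word d n, Integrable
        (fun ψ => contractPow ψ v x * star (contractPow ψ v x)) (haarPure d) := fun x =>
      Continuous.integrable_of_hasCompactSupport ((hc x).mul (hc x).star)
        (HasCompactSupport.of_compactSpace _)
    rw [integral_finsetSum _ fun x _ => hi x]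
    simp only [integral_contractPow_mul_star v hN hv]
    rw [← Finset.sum_div]
    have := trace_partialTraceLast (n := n) (k := k) (Matrix.vecMulVec v (star v))
    rw [trace_vecMulVec_star v hv1, Matrix.trace] at this
    simp only [Matrix.diag_apply] at this
    rw [this]
    push_cast; simp
  exact_mod_cast h

lemma weightedHaar_univ {N : ℕ} (hN0 : 0 < N)
    (hN : ∀ w z : Word d k, ∫ ψ, tensorPow ψ k w * star (tensorPow ψ k z) ∂haarPure d =
        (permCount w z : ℂ) / (N * k.factorial)) [IsFiniteMeasure (haarPure d)]
    (hv : v ∈ symmetricSubspace d (n + k)) (hv1 : l2norm v = 1) :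
    weightedHaar n k (Matrix.vecMulVec v (star v)) Set.univ = (N : ℝ≥0∞)⁻¹ := by
  rw [weightedHaar_vecMulVec, withDensity_apply _ MeasurableSet.univ, Measure.restrict_univ,
    ← ofReal_integral_eq_lintegral_ofReal (integrable_l2norm_contractPow_sq v)
      (Filter.Eventually.of_forall fun _ => sq_nonneg _),
    integral_l2norm_contractPow_sq v hN hv hv1, ENNReal.ofReal_inv_of_pos (by exact_mod_cast hN0),
    ENNReal.ofReal_natCast]

lemma integral_deFinettiMeasure {N : ℕ} (hN0 : 0 < N)
    (hN : ∀ w z : Word d k, ∫ ψ, tensorPow ψ k w * star (tensorPow ψ k z) ∂haarPure d =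
        (permCount w z : ℂ) / (N * k.factorial)) [IsFiniteMeasure (haarPure d)]
    (hv : v ∈ symmetricSubspace d (n + k)) (hv1 : l2norm v = 1) (f : PureState d → ℂ) :
    ∫ ψ, f ψ ∂deFinettiMeasure n k (Matrix.vecMulVec v (star v)) =
      N * ∫ ψ, (l2norm (contractPow ψ v) : ℂ) ^ 2 * f ψ ∂haarPure d := by
  rw [deFinettiMeasure, weightedHaar_univ v hN0 hN hv hv1, integral_smul_measure,
    weightedHaar_vecMulVec, integral_withDensity_eq_integral_toReal_smul]
  · simp only [inv_inv, ENNReal.toReal_natCast, Complex.real_smul, Complex.ofReal_natCast]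
    congr 2
    funext ψ
    rw [ENNReal.toReal_ofReal (sq_nonneg _), Complex.ofReal_pow]
  · exact (((continuous_l2norm.comp (continuous_contractPow v)).pow 2).measurable).ennreal_ofReal
  · exact Filter.Eventually.of_forall fun _ => ENNReal.ofReal_lt_top

end pure

lemma deFinettiMeasure_univ_le {d : ℕ} (n k : ℕ) (ρ : Op d (n + k)) :
    deFinettiMeasure n k ρ Set.univ ≤ 1 := by
  rw [deFinettiMeasure, Measure.smul_apply, smul_eq_mul]
  exact ENNReal.inv_mul_le_one _

/-! ### Permutation-invariant pure states -/

lemma exists_eq_vecMulVec {d m : ℕ} {ρ : Op d m} (hρ : IsDensity ρ) (hrank : ρ.rank = 1) :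
    ∃ v : Word d m → ℂ, l2norm v = 1 ∧ ρ = Matrix.vecMulVec v (star v) := by
  obtain ⟨x₀, hx₀⟩ : ∃ x, ρ x x ≠ 0 := by
    by_contra! h
    have := hρ.2
    rw [Matrix.trace] at this
    simp [h] at this
  have hherm : ∀ x y, star (ρ x y) = ρ y x := fun x y => hρ.1.1.apply y x
  obtain ⟨p, hp, hpx⟩ : ∃ p : ℝ, 0 ≤ p ∧ ρ x₀ x₀ = p := by
    have := hρ.1.diag_nonneg (i := x₀)
    exact ⟨(ρ x₀ x₀).re, (Complex.nonneg_iff.mp this).1, (Complex.ext rfl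
      (by rw [Complex.ofReal_im]; exact (Complex.nonneg_iff.mp this).2.symm))⟩
  obtain ⟨u, c, huc⟩ : ∃ (u c : Word d m → ℂ), ∀ x y, ρ x y = c y * u x := by
    rw [Matrix.rank, finrank_eq_one_iff'] at hrank
    obtain ⟨u, -, hu⟩ := hrank
    choose c hc using fun y => hu ⟨ρ *ᵥ Pi.single y 1, ⟨Pi.single y 1, rfl⟩⟩
    refine ⟨u, c, fun x y => ?_⟩
    have := congrFun (congrArg Subtype.val (hc y)) x
    simpa using this.symm
  have hp0 : (p : ℂ) ≠ 0 := hpx ▸ hx₀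
  have hs : ((Real.sqrt p : ℝ) : ℂ) * ((Real.sqrt p : ℝ) : ℂ) = p := by
    rw [← Complex.ofReal_mul, Real.mul_self_sqrt hp]
  have hv : ρ = Matrix.vecMulVec (fun x => ρ x x₀ / (Real.sqrt p : ℝ))
      (star fun x => ρ x x₀ / (Real.sqrt p : ℝ)) := by
    ext x y
    rw [Matrix.vecMulVec_apply, Pi.star_apply, star_div₀, hherm, Complex.star_def,
      Complex.conj_ofReal, div_mul_div_comm, hs, eq_div_iff hp0, ← hpx, huc x y, huc x₀ x₀,
      huc x x₀, huc x₀ y]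
    ring
  refine ⟨_, ?_, hv⟩
  have htr := hρ.2
  rw [hv, Matrix.trace_vecMulVec, dotProduct_comm, star_dotProduct_self] at htr
  have h1 : l2norm (fun x => ρ x x₀ / (Real.sqrt p : ℝ)) ^ 2 = 1 := by exact_mod_cast htr
  exact (pow_eq_one_iff_of_nonneg (l2norm_nonneg _) two_ne_zero).mp h1

/-- A permutation-invariant pure state is symmetric unless the number of subsystems is at most `d`:
the permutations act on its vector through a character, and any word with a nonzero amplitude
repeats a letter, so a transposition, hence every transposition, acts trivially. -/
lemma mem_symmetricSubspace_of_isPermInvariant {d m : ℕ} (hdm : d < m) {v : Word d m → ℂ}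
    (hv : IsPermInvariant (Matrix.vecMulVec v (star v))) : v ∈ symmetricSubspace d m := by
  by_cases h0 : v = 0
  · rw [h0]; exact Submodule.zero_mem _
  obtain ⟨x₀, hx₀⟩ := Function.ne_iff.mp h0
  replace hx₀ : v x₀ ≠ 0 := hx₀
  have hv' : ∀ (σ : Equiv.Perm (Fin m)) (x y : Word d m),
      v (x ∘ σ) * star (v (y ∘ σ)) = v x * star (v y) := hv
  have hχ : ∀ (σ : Equiv.Perm (Fin m)) (x : Word d m),
      v (x ∘ σ) = v (x₀ ∘ σ) / v x₀ * v x := by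
    intro σ x
    have h1 := hv' σ x x₀
    have h2 := hv' σ x₀ x₀
    have hne : star (v x₀) ≠ 0 := star_ne_zero.mpr hx₀
    have h3 : star (v (x₀ ∘ σ)) ≠ 0 := by
      intro h
      rw [h, mul_zero] at h2
      exact mul_ne_zero hx₀ hne h2.symm
    rw [div_mul_eq_mul_div, eq_div_iff hx₀]
    refine mul_right_cancel₀ h3 ?_
    calc v (x ∘ σ) * v x₀ * star (v (x₀ ∘ σ)) = (v (x ∘ σ) * star (v (x₀ ∘ σ))) * v x₀ := by ring
      _ = (v x₀ * star (v x₀)) * v x := by rw [h1]; ring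
      _ = _ := by rw [← h2]; ring
  let χ : Equiv.Perm (Fin m) →* ℂ :=
    { toFun := fun σ => v (x₀ ∘ σ) / v x₀
      map_one' := div_self hx₀
      map_mul' := fun σ τ => by
        have : v (x₀ ∘ ⇑(σ * τ)) = v (x₀ ∘ τ) / v x₀ * v (x₀ ∘ σ) := hχ τ (x₀ ∘ σ)
        rw [this]; ring }
  obtain ⟨i, j, hij, hxij⟩ := Fintype.exists_ne_map_eq_of_card_lt x₀ (by simpa using hdm)
  have hswap : χ (Equiv.swap i j) = 1 := by
    have : x₀ ∘ Equiv.swap i j = x₀ := by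
      funext l
      rcases eq_or_ne l i with rfl | hi
      · simp [hxij]
      rcases eq_or_ne l j with rfl | hj
      · simp [hxij]
      · simp [Equiv.swap_apply_of_ne_of_ne hi hj]
    change v (x₀ ∘ Equiv.swap i j) / v x₀ = 1
    rw [this, div_self hx₀]
  have hall : ∀ σ, χ σ = 1 := by
    intro σ
    induction σ using Equiv.Perm.swap_induction_on with
    | one => exact map_one χ
    | swap_mul f a b hab ih =>
      have := χ.map_isConj (Equiv.Perm.isConj_swap hab hij)
      rw [map_mul, ih, isConj_iff_eq.mp this, hswap, one_mul]
  intro σ x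
  have : v (x₀ ∘ σ) / v x₀ = 1 := hall σ
  rw [hχ σ x, this, one_mul]

lemma mem_symmetricSubspace_of_supportedOn {d m : ℕ} {v : Word d m → ℂ} (hv1 : l2norm v = 1)
    (h : SupportedOn (Matrix.vecMulVec v (star v)) (symmetricSubspace d m)) :
    v ∈ symmetricSubspace d m := by
  have := h ⟨v, rfl⟩
  rw [Matrix.mulVecLin_apply, Matrix.vecMulVec_mulVec, star_dotProduct_self, hv1] at this
  simpa using this

lemma l2norm_tensorPow {d n : ℕ} (ψ : PureState d) : l2norm (tensorPow ψ n) = 1 := by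
  have h : l2norm (tensorPow ψ n) ^ 2 = 1 := by
    have := star_dotProduct_self (tensorPow ψ n)
    rw [dotProduct_comm, dotProduct] at this
    simp only [Pi.star_apply, sum_tensorPow_mul_star] at this
    exact_mod_cast this.symm
  exact (pow_eq_one_iff_of_nonneg (l2norm_nonneg _) two_ne_zero).mp h

lemma tensorPow_mem_hammingBall {d n r : ℕ} (ψ : PureState d) :
    tensorPow ψ n ∈ hammingBall r (tensorPow ψ n) := by
  refine Submodule.subset_span ⟨1, ⟨one_mem _, Finset.univ, by simp, 1, fun x y => ?_⟩, by simp⟩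
  simp [Matrix.one_apply, funext_iff]

/-! ### The approximating states and the trace norm bound -/

/-- The trivial bound: a reduced state and a mixture of pure states of total weight at most one differ
by at most two in trace norm. -/
lemma traceNorm_sub_mixture_le_two {d n k : ℕ} {v : Word d (n + k) → ℂ} (hv1 : l2norm v = 1)
    {ν : Measure (PureState d)} (hν : ν Set.univ ≤ 1) {t : PureState d → Word d n → ℂ}
    (htm : Measurable t) (ht : ∀ ψ, l2norm (t ψ) = 1) :
    traceNorm (partialTraceLast n k (Matrix.vecMulVec v (star v)) -
      mixture ν fun ψ => Matrix.vecMulVec (t ψ) (star (t ψ))) ≤ 2 := by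
  have : IsFiniteMeasure ν := ⟨hν.trans_lt ENNReal.one_lt_top⟩
  obtain ⟨W, hWA, hW⟩ := exists_contraction_traceNorm_eq
    (partialTraceLast n k (Matrix.vecMulVec v (star v)) -
      mixture ν fun ψ => Matrix.vecMulVec (t ψ) (star (t ψ)))
  rw [mul_sub, Matrix.trace_sub, trace_mul_mixture ν htm ht] at hWA
  have h1 : ‖(W * partialTraceLast n k (Matrix.vecMulVec v (star v))).trace‖ ≤ 1 := by
    have hsum : partialTraceLast n k (Matrix.vecMulVec v (star v)) = ∑ z : Word d k,
        Matrix.vecMulVec (fun x => v (Fin.append x z)) (star fun x => v (Fin.append x z)) := by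
      ext x y
      rw [Matrix.sum_apply]
      rfl
    rw [hsum, Matrix.mul_sum, Matrix.trace_sum]
    simp only [Matrix.trace_mul_vecMulVec_star]
    calc _ ≤ ∑ z : Word d k, l2norm (fun x => v (Fin.append x z)) ^ 2 := by
          refine (norm_sum_le _ _).trans (Finset.sum_le_sum fun z _ => ?_)
          rw [sq]
          exact hW _ _
      _ = l2norm v ^ 2 := by
          simp only [l2norm_sq]
          rw [sum_word_append, Finset.sum_comm]
      _ = 1 := by rw [hv1, one_pow]
      _ ≤ 1 := le_rfl
  have h2 : ‖∫ ψ, star (t ψ) ⬝ᵥ (W *ᵥ t ψ) ∂ν‖ ≤ 1 := by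
    refine (norm_integral_le_of_norm_le_const (C := 1)
      (Filter.Eventually.of_forall fun ψ => ?_)).trans ?_
    · exact (hW _ _).trans_eq (by rw [ht, one_mul])
    · rw [one_mul]
      exact ENNReal.toReal_le_of_le_ofReal zero_le_one (by simpa using hν)
  have h3 : ‖(traceNorm (partialTraceLast n k (Matrix.vecMulVec v (star v)) -
      mixture ν fun ψ => Matrix.vecMulVec (t ψ) (star (t ψ))) : ℂ)‖ ≤ 2 := by
    rw [hWA]
    exact (norm_sub_le _ _).trans (by linarith)
  rw [Complex.norm_real] at h3
  exact (le_abs_self _).trans h3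

/-- The normalized component of `(𝕀 ⊗ ⟨ψ|^{⊗k}) v` with at most `r` errors; it is `|ψ⟩^{⊗n}` if
that component vanishes. -/
noncomputable def approxState {d n k : ℕ} (r : ℕ) (v : Word d (n + k) → ℂ) (ψ : PureState d) :
    Word d n → ℂ :=
  open scoped Classical in
  if fewErrorsProj r ψ *ᵥ contractPow ψ v = 0 then tensorPow ψ n else
    ((l2norm (fewErrorsProj r ψ *ᵥ contractPow ψ v))⁻¹ : ℂ) • (fewErrorsProj r ψ *ᵥ contractPow ψ v)

section approxState
variable {d n k : ℕ} (r : ℕ) (v : Word d (n + k) → ℂ)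

lemma measurable_approxState : Measurable (approxState (n := n) (k := k) r v) := by
  have hb := continuous_fewErrorsProj_mulVec r (continuous_contractPow (n := n) (k := k) v)
  refine Measurable.ite (measurableSet_eq_fun hb.measurable measurable_const)
    (continuous_pi fun x => continuous_tensorPow x).measurable ?_
  refine measurable_pi_iff.mpr fun x => Measurable.mul ?_ ((measurable_pi_apply x).comp hb.measurable)
  exact (Complex.continuous_ofReal.comp (continuous_l2norm.comp hb)).measurable.inv

lemma l2norm_approxState (ψ : PureState d) : l2norm (approxState (n := n) (k := k) r v ψ) = 1 := by
  unfold approxState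
  split_ifs with h
  · exact l2norm_tensorPow ψ
  · rw [l2norm_smul, norm_inv, Complex.norm_real, Real.norm_of_nonneg (l2norm_nonneg _),
      inv_mul_cancel₀ (fun h0 => h (l2norm_eq_zero.mp h0))]

lemma l2norm_smul_approxState (ψ : PureState d) :
    fewErrorsProj r ψ *ᵥ contractPow ψ v =
      (l2norm (fewErrorsProj r ψ *ᵥ contractPow (n := n) (k := k) ψ v) : ℂ) •
        approxState r v ψ := by
  unfold approxState
  split_ifs with h
  · rw [h, l2norm_eq_zero.mpr rfl]; simp
  · rw [smul_smul, mul_inv_cancel₀, one_smul]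
    exact_mod_cast fun h0 => h (l2norm_eq_zero.mp h0)

lemma approxState_mem_hammingBall (ψ : PureState d) :
    approxState (n := n) (k := k) r v ψ ∈ hammingBall r (tensorPow ψ n) := by
  unfold approxState
  split_ifs with h
  · exact tensorPow_mem_hammingBall ψ
  · exact Submodule.smul_mem _ _ (fewErrorsProj_mulVec_mem_hammingBall r ψ _)

/-- The de Finetti bound for symmetric vectors; `N` is the dimension of the symmetric subspace of
`(ℂ^d)^{⊗k}`. -/
lemma traceNorm_sub_mixture_approxState_le {N : ℕ} (hn : 1 ≤ n) (hN0 : 0 < N)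
    (hN : ∀ w z : Word d k, ∫ ψ, tensorPow ψ k w * star (tensorPow ψ k z) ∂haarPure d =
        (permCount w z : ℂ) / (N * k.factorial)) [IsProbabilityMeasure (haarPure d)]
    (hv : v ∈ symmetricSubspace d (n + k)) (hv1 : l2norm v = 1) :
    traceNorm (partialTraceLast n k (Matrix.vecMulVec v (star v)) -
      mixture (deFinettiMeasure n k (Matrix.vecMulVec v (star v)))
        fun ψ => Matrix.vecMulVec (approxState r v ψ) (star (approxState r v ψ))) ≤
      N * (3 * Real.exp (-((r : ℝ) / 6) * min ((k : ℝ) / n) 1)) := by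
  set ν := deFinettiMeasure n k (Matrix.vecMulVec v (star v)) with hν
  set t : PureState d → Word d n → ℂ := approxState r v with ht
  set ε := Real.exp (-((r : ℝ) / 6) * min ((k : ℝ) / n) 1) with hε
  have : IsFiniteMeasure ν := ⟨(deFinettiMeasure_univ_le n k _).trans_lt ENNReal.one_lt_top⟩
  have htm : Measurable t := measurable_approxState r v
  have ht1 : ∀ ψ, l2norm (t ψ) = 1 := l2norm_approxState r v
  have hNC : (N : ℂ) ≠ 0 := Nat.cast_ne_zero.mpr hN0.ne'
  obtain ⟨W, hWA, hW⟩ := exists_contraction_traceNorm_eq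
    (partialTraceLast n k (Matrix.vecMulVec v (star v)) -
      mixture ν fun ψ => Matrix.vecMulVec (t ψ) (star (t ψ)))
  rw [mul_sub, Matrix.trace_sub, trace_mul_mixture ν htm ht1, hν,
    integral_deFinettiMeasure v hN0 hN hv hv1] at hWA
  have hc := continuous_contractPow v (n := n) (k := k)
  have hc' := continuous_pi_iff.mp hc
  have hpt : (W * partialTraceLast n k (Matrix.vecMulVec v (star v))).trace =
      N * ∫ ψ, star (contractPow ψ v) ⬝ᵥ (W *ᵥ contractPow (n := n) (k := k) ψ v) ∂haarPure d := by
    have hentry : ∀ x y, partialTraceLast n k (Matrix.vecMulVec v (star v)) x y =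
        N * ∫ ψ, contractPow ψ v x * star (contractPow ψ v y) ∂haarPure d := by
      intro x y
      rw [integral_contractPow_mul_star v hN hv, mul_div_cancel₀ _ hNC]
    have hi : ∀ x y : Word d n, Integrable
        (fun ψ => contractPow ψ v x * star (contractPow ψ v y)) (haarPure d) := fun x y =>
      Continuous.integrable_of_hasCompactSupport ((hc' x).mul (hc' y).star)
        (HasCompactSupport.of_compactSpace _)
    have hexp : ∀ ψ : PureState d,
        star (contractPow ψ v) ⬝ᵥ (W *ᵥ contractPow (n := n) (k := k) ψ v) =
          ∑ x, ∑ y, W x y * (contractPow ψ v y * star (contractPow ψ v x)) := by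
      intro ψ
      simp only [dotProduct, Matrix.mulVec, Finset.mul_sum, Pi.star_apply]
      exact Finset.sum_congr rfl fun x _ => Finset.sum_congr rfl fun y _ => by ring
    have htr : ∀ M : Op d n, (W * M).trace = ∑ x, ∑ y, W x y * M y x := fun M => rfl
    simp only [hexp]
    rw [integral_finsetSum _ fun x _ => integrable_finsetSum _ fun y _ => (hi y x).const_mul (W x y),
      htr, Finset.mul_sum]
    refine Finset.sum_congr rfl fun x _ => ?_
    rw [integral_finsetSum _ fun y _ => (hi y x).const_mul (W x y), Finset.mul_sum]
    refine Finset.sum_congr rfl fun y _ => ?_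
    rw [integral_const_mul, hentry]
    ring
  have hBc : ∀ {s : PureState d → Word d n → ℂ}, Measurable s →
      Measurable fun ψ => star (s ψ) ⬝ᵥ (W *ᵥ s ψ) := by
    intro s hs
    have hq : Continuous fun x : Word d n → ℂ => star x ⬝ᵥ (W *ᵥ x) :=
      Continuous.dotProduct continuous_star (Continuous.matrix_mulVec continuous_const continuous_id)
    exact hq.measurable.comp hs
  have hle : ∀ ψ : PureState d, l2norm (contractPow (n := n) ψ v) ≤ 1 := fun ψ =>
    (l2norm_contractPow_le ψ v).trans_eq hv1
  have hi1 : Integrable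
      (fun ψ => star (contractPow ψ v) ⬝ᵥ (W *ᵥ contractPow (n := n) (k := k) ψ v)) (haarPure d) := by
    refine Integrable.of_bound (C := 1) (hBc hc.measurable).aestronglyMeasurable
      (Filter.Eventually.of_forall fun ψ => ?_)
    exact (hW _ _).trans (mul_le_one₀ (hle ψ) (l2norm_nonneg _) (hle ψ))
  have hi2 : Integrable
      (fun ψ => (l2norm (contractPow (n := n) ψ v) : ℂ) ^ 2 * (star (t ψ) ⬝ᵥ (W *ᵥ t ψ)))
      (haarPure d) := by
    refine Integrable.of_bound (C := 1) ?_ (Filter.Eventually.of_forall fun ψ => ?_)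
    · exact (((Complex.continuous_ofReal.comp (continuous_l2norm.comp hc)).pow 2).measurable.mul
        (hBc htm)).aestronglyMeasurable
    · rw [norm_mul, norm_pow, Complex.norm_real, Real.norm_of_nonneg (l2norm_nonneg _)]
      have h1 := hW (t ψ) (t ψ)
      rw [ht1, one_mul] at h1
      exact mul_le_one₀ (pow_le_one₀ (l2norm_nonneg _) (hle ψ)) (norm_nonneg _) h1
  rw [hpt, ← mul_sub, ← integral_sub hi1 hi2] at hWA
  have hbound : ‖∫ ψ, (star (contractPow ψ v) ⬝ᵥ (W *ᵥ contractPow (n := n) (k := k) ψ v) -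
      (l2norm (contractPow (n := n) ψ v) : ℂ) ^ 2 * (star (t ψ) ⬝ᵥ (W *ᵥ t ψ))) ∂haarPure d‖ ≤
      3 * ε := by
    refine (norm_integral_le_of_norm_le_const (C := 3 * ε)
      (Filter.Eventually.of_forall fun ψ => ?_)).trans (by simp)
    refine (norm_expectation_sub_le hW (b := fewErrorsProj r ψ *ᵥ contractPow ψ v)
      (e := contractPow ψ v - fewErrorsProj r ψ *ᵥ contractPow ψ v) (by simp)
      (l2norm_fewErrorsProj_sq_add r ψ _) (ht1 ψ) (l2norm_smul_approxState r v ψ)).trans ?_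
    have h1 := l2norm_sub_fewErrorsProj_contractPow_le r ψ hn hv hv1
    have h2 := l2norm_nonneg (contractPow ψ v - fewErrorsProj r ψ *ᵥ contractPow (n := n) ψ v)
    have h3 : l2norm (contractPow ψ v - fewErrorsProj r ψ *ᵥ contractPow (n := n) ψ v) *
        l2norm (contractPow (n := n) ψ v) ≤ ε :=
      (mul_le_of_le_one_right h2 (hle ψ)).trans h1
    linarith
  have h4 := congrArg norm hWA
  rw [Complex.norm_real, norm_mul, Complex.norm_natCast] at h4
  refine (le_abs_self _).trans (h4.le.trans ?_)
  exact mul_le_mul_of_nonneg_left hbound (Nat.cast_nonneg N)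

end approxState

lemma two_le_bound {d n k r : ℕ} (hd : 1 ≤ d) (hnk : 2 ≤ n + k) (hr : r ≤ d) :
    2 ≤ ((n + k : ℕ) : ℝ) ^ (3 * d) * Real.exp (-((r : ℝ) / 6) * min ((k : ℝ) / (n : ℝ)) 1) := by
  have h1 : (2 : ℝ) ^ (3 * d) ≤ ((n + k : ℕ) : ℝ) ^ (3 * d) :=
    pow_le_pow_left₀ zero_le_two (by exact_mod_cast hnk) _
  have hmin : min ((k : ℝ) / (n : ℝ)) 1 ≤ 1 := min_le_right _ _
  have hmin0 : 0 ≤ min ((k : ℝ) / (n : ℝ)) 1 := le_min (by positivity) zero_le_one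
  have hrd : (r : ℝ) ≤ d := by exact_mod_cast hr
  have h2 : Real.exp (-(d : ℝ)) ≤ Real.exp (-((r : ℝ) / 6) * min ((k : ℝ) / (n : ℝ)) 1) := by
    refine Real.exp_le_exp.mpr ?_
    have hr0 : (0 : ℝ) ≤ r := Nat.cast_nonneg r
    nlinarith [mul_le_mul_of_nonneg_left hmin (by positivity : (0 : ℝ) ≤ (r : ℝ) / 6)]
  have h3 : (4 : ℝ) ^ d * Real.exp (-(d : ℝ)) ≥ 1 := by
    have h4 : Real.exp (-(d : ℝ)) = (Real.exp 1)⁻¹ ^ d := by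
      rw [← Real.exp_neg, ← Real.exp_nat_mul]; congr 1; ring
    rw [h4, ← mul_pow]
    refine one_le_pow₀ ?_
    rw [← div_eq_mul_inv, le_div_iff₀ (Real.exp_pos 1)]
    linarith [Real.exp_one_lt_d9]
  calc (2 : ℝ) ≤ 2 ^ d * 1 := by
        rw [mul_one]; exact le_self_pow₀ one_le_two (by omega)
    _ ≤ 2 ^ d * (4 ^ d * Real.exp (-(d : ℝ))) := mul_le_mul_of_nonneg_left h3 (by positivity)
    _ = 2 ^ (3 * d) * Real.exp (-(d : ℝ)) := by
        rw [← mul_assoc, ← mul_pow, pow_mul]; norm_num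
    _ ≤ _ := mul_le_mul h1 h2 (Real.exp_nonneg _) (by positivity)

theorem theorem1 :
    ∃ C : ℕ, ∀ (d n k : ℕ), 1 ≤ n → 2 ≤ n + k →
      ∀ ρ : Op d (n + k), IsDensity ρ → ρ.rank = 1 → IsPermInvariant ρ →
        (SupportedOn ρ (symmetricSubspace d (n + k)) →
          MeasureTheory.IsProbabilityMeasure (deFinettiMeasure n k ρ)) ∧
        ∀ r : ℕ, r ≤ n →
          ∃ τ : PureState d → Op d n,
            (∀ ψ : PureState d, IsDensity (τ ψ) ∧
              quantumHammingDist (τ ψ) (tensorPow ψ n) ≤ (r : ℕ∞)) ∧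
            (∀ x y : Word d n,
              MeasureTheory.Integrable (fun ψ => τ ψ x y) (deFinettiMeasure n k ρ)) ∧
            traceNorm (partialTraceLast n k ρ - mixture (deFinettiMeasure n k ρ) τ) ≤
              ((n + k : ℕ) : ℝ) ^ (C * d) *
                Real.exp (-((r : ℝ) / 6) * min ((k : ℝ) / (n : ℝ)) 1) := by
  refine ⟨3, fun d n k hn hnk ρ hρ hrank hperm => ?_⟩
  have hd : 0 < d := by
    rcases Nat.eq_zero_or_pos d with rfl | h
    · have hempty : IsEmpty (Word 0 (n + k)) := ⟨fun x => (x ⟨0, by omega⟩).elim0⟩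
      have := hρ.2
      rw [Matrix.trace, Finset.univ_eq_empty, Finset.sum_empty] at this
      exact absurd this zero_ne_one
    · exact h
  have := isProbabilityMeasure_haarPure hd
  obtain ⟨v, hv1, rfl⟩ := exists_eq_vecMulVec hρ hrank
  obtain ⟨N, hN0, hNle, hN⟩ := integral_tensorPow_mul_star hd k
  have hfin : IsFiniteMeasure (deFinettiMeasure n k (Matrix.vecMulVec v (star v))) :=
    ⟨(deFinettiMeasure_univ_le n k _).trans_lt ENNReal.one_lt_top⟩
  refine ⟨fun hsupp => ⟨?_⟩, fun r hr => ?_⟩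
  · have hv := mem_symmetricSubspace_of_supportedOn hv1 hsupp
    rw [deFinettiMeasure, Measure.smul_apply, smul_eq_mul, weightedHaar_univ v hN0 hN hv hv1]
    exact ENNReal.inv_mul_cancel (ENNReal.inv_ne_zero.mpr (ENNReal.natCast_ne_top N))
      (ENNReal.inv_ne_top.mpr (Nat.cast_ne_zero.mpr hN0.ne'))
  · refine ⟨fun ψ => Matrix.vecMulVec (approxState r v ψ) (star (approxState r v ψ)), fun ψ =>
      ⟨isDensity_vecMulVec (l2norm_approxState r v ψ),
        quantumHammingDist_vecMulVec_le hr (approxState_mem_hammingBall r v ψ)⟩,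
      integrable_vecMulVec_apply _ (measurable_approxState r v) (l2norm_approxState r v), ?_⟩
    rcases le_or_gt (n + k) d with hle | hlt
    · -- Antisymmetric vectors occur only here, and then the claimed bound exceeds the trivial one.
      exact (traceNorm_sub_mixture_le_two hv1 (deFinettiMeasure_univ_le n k _)
        (measurable_approxState r v) (l2norm_approxState r v)).trans
          (two_le_bound hd hnk (by omega))
    · have hv := mem_symmetricSubspace_of_isPermInvariant hlt hperm
      refine (traceNorm_sub_mixture_approxState_le r v hn hN0 hN hv hv1).trans ?_
      rw [← mul_assoc]
      refine mul_le_mul_of_nonneg_right ?_ (Real.exp_nonneg _)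
      have h : N * 3 ≤ (n + k) ^ (3 * d) := by
        calc N * 3 ≤ (n + k) ^ d * ((n + k) ^ 2) ^ d := by
              refine Nat.mul_le_mul (hNle.trans (Nat.pow_le_pow_left (by omega) d)) ?_
              refine le_trans ?_ (Nat.le_self_pow hd.ne' _)
              nlinarith
          _ = (n + k) ^ (3 * d) := by rw [← pow_mul, ← pow_add]; congr 1; ring
      exact_mod_cast h
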